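/- Let $d\ge 1$ be an integer, $\delta>0$, $\mathbf k\in\mathbb R^d\setminus\{0\}$, $k=|\mathbf k|$, and for $\alpha\in[0,d+2)$ let $$\rho_\delta(r)=\frac{2\Gamma(\frac d2+1)(d+2-\alpha)}{\pi^{d/2}\,\delta^{d+2-\alpha}\,r^{\alpha}}\,\chi_{[0,\delta]}(r),\qquad \lambda_\delta(\mathbf k)=\lim_{\varepsilon\to0^+}\int_{\varepsilon\le|\mathbf r|\le\delta}\rho_\delta(|\mathbf r|)\left(e^{i\mathbf k\cdot\mathbf r}-1\right)d\mathbf r .$$ Let $J_\nu$, $Y_\nu$ be the Bessel functions of the first and second kind and let $S_{\mu,\nu}$ be the Lommel function $$S_{\mu,\nu}(z)=z^{\mu+1}\sum_{n\ge0}\frac{(-1)^nz^{2n}}{\prod_{m=1}^{n+1}\left[(\mu+2m-1)^2-\nu^2\right]}+2^{\mu-1}\Gamma(\tfrac{\mu+\nu+1}2)\Gamma(\tfrac{\mu-\nu+1}2)\left[\sin(\tfrac{(\mu-\nu)\pi}2)J_\nu(z)-\cos(\tfrac{(\mu-\nu)\pi}2)Y_\nu(z)\right],$$ the right-hand side being replaced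 by its limit in $\mu$ when $\mu+\nu$ or $\mu-\nu$ is a negative odd integer. Write $$A(\alpha)=\left(\frac{k\delta}2\right)^{\alpha-d}\frac{\Gamma(\frac{d-\alpha}2)}{\Gamma(\frac\alpha2)}-\frac{2}{(d-\alpha)\Gamma(\frac d2)}\quad(\alpha\ne d),$$ where $1/\Gamma(0)=0$, and $$B(\alpha)=2^{\frac d2}(k\delta)^{\alpha+1-d}\left[(d-2-\alpha)J_{\frac{d-2}2}(k\delta)S_{\frac{d-2-2\alpha}2,\frac{d-4}2}(k\delta)-J_{\frac{d-4}2}(k\delta)S_{\frac{d-2\alpha}2,\frac{d-2}2}(k\delta)\right].$$ Then: 1. The limit defining $\lambda_\delta(\mathbf k)$ exists for every $\alpha\in[0,d+2)$. For $\alpha<d+1$ the integral over the whole ball $|\mathbf r|\le\delta$ converges absolutely and equals $\lambda_\delta(\mathbf k)$. 2. For every $\alpha\in[0,d+2)$ with $\alpha\neq d$, $$\frac{\delta^2\lambda_\delta(\mathbf k)}{2\Gamma(\frac d2+1)(d+2-\alpha)}=A(\alpha)+B(\alpha).$$ 3. The singularity of $A$ at $\alpha=d$ is removable: $$\lim_{\alpha\to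 d}A(\alpha)=A(d):=\frac1{\Gamma(\frac d2)}\left[2\log\left(\frac2{k\delta}\right)+\Gamma'(1)+\frac{\Gamma'(\frac d2)}{\Gamma(\frac d2)}\right],$$ and with this value of $A(d)$ the identity in 2 also holds for $\alpha=d$. 4. With this value of $A(d)$, both sides of the identity are real-analytic functions of $\alpha\in[0,d+2)$. -/

import Mathlib

open Set Filter Topology MeasureTheory

noncomputable section

namespace NonlocalSpectra

/-- Bessel function of the first kind of real order `ν` at a positive real argument,
`J_ν(z) = (z/2)^ν ∑ (-z²/4)^n / (n! Γ(ν+n+1))`. At the poles of `Γ` Mathlib has `Γ = 0`, so that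
the corresponding summands vanish, as the convention `1/Γ = 0` demands. -/
def besselJ (ν z : ℝ) : ℝ :=
  (z / 2) ^ ν * ∑' n : ℕ, (-(z ^ 2) / 4) ^ n / ((n.factorial : ℝ) * Real.Gamma (ν + n + 1))

/-- `(J_ν(z) cos(νπ) - J_{-ν}(z)) / sin(νπ)`, meaningful for non-integral `ν`. -/
def besselYGeneric (ν z : ℝ) : ℝ :=
  (besselJ ν z * Real.cos (ν * Real.pi) - besselJ (-ν) z) / Real.sin (ν * Real.pi)

open Classical in
/-- Bessel function of the second kind of real order `ν` at a positive real argument; for integral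
order the defining quotient is replaced by its limit in the order. -/
def besselY (ν z : ℝ) : ℝ :=
  if ∃ n : ℤ, ν = n then limUnder (𝓝[≠] ν) (fun w => besselYGeneric w z) else besselYGeneric ν z

/-- The Lommel function `s_{μ,ν}(z) = z^(μ+1) ∑ (-1)^n z^(2n) / ∏_{m=1}^{n+1} ((μ+2m-1)² - ν²)`,
meaningful if neither `μ + ν` nor `μ - ν` is a negative odd integer. -/
def lommelSmall (μ ν z : ℝ) : ℝ :=
  z ^ (μ + 1) * ∑' n : ℕ, (-1) ^ n * z ^ (2 * n) /
    ∏ m ∈ Finset.Icc 1 (n + 1), ((μ + 2 * (m : ℝ) - 1) ^ 2 - ν ^ 2)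

/-- The Lommel function `S_{μ,ν}(z)` where neither `μ + ν` nor `μ - ν` is a negative odd
integer. -/
def lommelSGeneric (μ ν z : ℝ) : ℝ :=
  lommelSmall μ ν z +
    2 ^ (μ - 1) * Real.Gamma ((μ + ν + 1) / 2) * Real.Gamma ((μ - ν + 1) / 2) *
      (Real.sin ((μ - ν) * Real.pi / 2) * besselJ ν z -
        Real.cos ((μ - ν) * Real.pi / 2) * besselY ν z)

open Classical in
/-- The Lommel function `S_{μ,ν}(z)` for all real `μ`, `ν` and positive real `z`; where `μ + ν` or
`μ - ν` is a negative odd integer the defining formula is replaced by its limit in `μ`. -/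
def lommelS (μ ν z : ℝ) : ℝ :=
  if ∃ n : ℕ, μ + ν = -(2 * (n : ℝ) + 1) ∨ μ - ν = -(2 * (n : ℝ) + 1) then
    limUnder (𝓝[≠] μ) (fun w => lommelSGeneric w ν z)
  else lommelSGeneric μ ν z

/-- The algebraic kernel
`ρ_δ(r) = 2 Γ(d/2+1) (d+2-α) / (π^(d/2) δ^(d+2-α) r^α)` on `[0,δ]`, and `0` elsewhere. -/
def algebraicKernel (d : ℕ) (α δ r : ℝ) : ℝ :=
  (Icc 0 δ).indicator (fun s : ℝ =>
    2 * Real.Gamma ((d : ℝ) / 2 + 1) * ((d : ℝ) + 2 - α) /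
      (Real.pi ^ ((d : ℝ) / 2) * δ ^ ((d : ℝ) + 2 - α) * s ^ α)) r

/-- The integrand `ρ_δ(|r|) (e^{i k·r} - 1)` of the eigenvalue. -/
def eigenvalueIntegrand (d : ℕ) (α δ : ℝ) (k r : EuclideanSpace ℝ (Fin d)) : ℂ :=
  (algebraicKernel d α δ ‖r‖ : ℂ) * (Complex.exp (Complex.I * ((inner ℝ k r : ℝ) : ℂ)) - 1)

/-- The integral of `ρ_δ(|r|) (e^{i k·r} - 1)` over `ε ≤ |r| ≤ δ`. -/
def truncatedEigenvalue (d : ℕ) (α δ : ℝ) (k : EuclideanSpace ℝ (Fin d)) (ε : ℝ) : ℂ :=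
  ∫ r in Metric.closedBall 0 δ \ Metric.ball 0 ε, eigenvalueIntegrand d α δ k r

/-- The eigenvalue `λ_δ(k) = ∫_{B_δ(0)} ρ_δ(|r|) (e^{i k·r} - 1) dr` of nonlocal diffusion. The
integral is a principal value at the origin: for `d + 1 ≤ α < d + 2` it does not converge
absolutely. -/
def eigenvalue (d : ℕ) (α δ : ℝ) (k : EuclideanSpace ℝ (Fin d)) : ℂ :=
  limUnder (𝓝[>] (0 : ℝ)) (truncatedEigenvalue d α δ k)

/-- `δ² λ_δ(k) / (2 Γ(d/2+1) (d+2-α))`. -/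
def scaledEigenvalue (d : ℕ) (α δ : ℝ) (k : EuclideanSpace ℝ (Fin d)) : ℂ :=
  (δ : ℂ) ^ 2 * eigenvalue d α δ k /
    ((2 * Real.Gamma ((d : ℝ) / 2 + 1) * ((d : ℝ) + 2 - α) : ℝ) : ℂ)

/-- `(a/2)^(α-d) Γ((d-α)/2) / Γ(α/2) - 2 / ((d-α) Γ(d/2))`, meaningful for `α ≠ d`. For `α = 0` the
first term is `0`, in accordance with `1/Γ(0) = 0`. -/
def gammaPart (d : ℕ) (a α : ℝ) : ℝ :=
  (a / 2) ^ (α - d) * Real.Gamma (((d : ℝ) - α) / 2) / Real.Gamma (α / 2) -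
    2 / (((d : ℝ) - α) * Real.Gamma ((d : ℝ) / 2))

/-- `(2 log(2/a) + Γ'(1) + Γ'(d/2)/Γ(d/2)) / Γ(d/2)`. -/
def gammaPartAtDim (d : ℕ) (a : ℝ) : ℝ :=
  1 / Real.Gamma ((d : ℝ) / 2) *
    (2 * Real.log (2 / a) + deriv Real.Gamma 1 +
      deriv Real.Gamma ((d : ℝ) / 2) / Real.Gamma ((d : ℝ) / 2))

/-- `2^(d/2) a^(α+1-d) [(d-2-α) J_{(d-2)/2}(a) S_{(d-2-2α)/2,(d-4)/2}(a)
- J_{(d-4)/2}(a) S_{(d-2α)/2,(d-2)/2}(a)]`. -/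
def besselLommelPart (d : ℕ) (a α : ℝ) : ℝ :=
  2 ^ ((d : ℝ) / 2) * a ^ (α + 1 - d) *
    (((d : ℝ) - 2 - α) * besselJ (((d : ℝ) - 2) / 2) a *
        lommelS (((d : ℝ) - 2 - 2 * α) / 2) (((d : ℝ) - 4) / 2) a -
      besselJ (((d : ℝ) - 4) / 2) a * lommelS (((d : ℝ) - 2 * α) / 2) (((d : ℝ) - 2) / 2) a)

end NonlocalSpectra

end

namespace NonlocalSpectra

/-! Both sides of the identity equal one series in $-(k\delta/2)^2$, `spectralSeries`. On the
integral side the annuli are symmetric under $\mathbf r\mapsto-\mathbf r$, so only $\cos(\mathbf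
k\cdot\mathbf r)-1$ survives. It is $O(|\mathbf r|^2)$ and hence absolutely integrable against the
kernel for $\alpha<d+2$. Expanding the cosine and integrating termwise leaves even moments of a
radial function; their spherical factor is found by testing with a Gaussian
(`integral_norm_mul_inner_even_pow`, `integral_algebraicKernel_mul_cos_sub_one`).

On the Bessel–Lommel side everything is written through $\sum x^n/(\Gamma(b+n+1)\Gamma(c+n+1))$,
which is entire in $b$ and in $c$. With $c=(\mu-\nu+1)/2$, the function $S_{\mu,\nu}$ is $2^{\mu-1}$
times an entire function of $c$ divided by $1/(\Gamma(c+\nu)\Gamma(c))$. The numerator vanishes to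
the order of the denominator, so the exceptional values are removable and $S$ is continuous in $\mu$
(`continuousAt_lommelS`).

At generic parameters the combination of $J$ and $S$ splits into three parts. The series part
satisfies a first-order Euler equation, which gives the summands their denominators $n+(d-\alpha)/2$
(`coeff_crossPowerSeries`). The $J_\nu J_{\nu-1}$ products cancel. The $Y$ part is a Wronskian times
$\sin(c\pi)$, turned into a Gamma quotient by reflection. These Gamma terms and the summand $n=0$
are exactly what $A(\alpha)$ compensates. Continuity in $\alpha$ extends the identity to all
$\alpha<d+2$, including $\alpha=d$, and analyticity is read off the series. -/

/-! ### The reciprocal Gamma function: zeros and decay. -/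

/-- The reciprocal Gamma function, an entire function. -/
noncomputable def rGamma (s : ℂ) : ℂ := (Complex.Gamma s)⁻¹

theorem differentiable_rGamma : Differentiable ℂ rGamma :=
  Complex.differentiable_one_div_Gamma

theorem rGamma_eq_mul (s : ℂ) : rGamma s = s * rGamma (s + 1) :=
  Complex.one_div_Gamma_eq_self_mul_one_div_Gamma_add_one s

theorem rGamma_neg_nat (n : ℕ) : rGamma (-n) = 0 := by
  simp [rGamma, Complex.Gamma_neg_nat_eq_zero]

theorem rGamma_zero : rGamma 0 = 0 := by
  simpa using rGamma_neg_nat 0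

theorem rGamma_eq_zero_iff (s : ℂ) : rGamma s = 0 ↔ ∃ n : ℕ, s = -n := by
  rw [rGamma, inv_eq_zero, Complex.Gamma_eq_zero_iff]

theorem rGamma_nat_add_one (n : ℕ) : rGamma (n + 1) = (n.factorial : ℂ)⁻¹ := by
  rw [rGamma, Complex.Gamma_nat_eq_factorial]

theorem rGamma_ofReal (s : ℝ) : rGamma s = ((Real.Gamma s)⁻¹ : ℝ) := by
  rw [rGamma, Complex.Gamma_ofReal]; push_cast; rfl

theorem rGamma_mul_one_sub (z : ℂ) :
    rGamma z * rGamma (1 - z) = Complex.sin (Real.pi * z) / Real.pi := by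
  rw [rGamma, rGamma, ← mul_inv, Complex.Gamma_mul_Gamma_one_sub, inv_div]

/-- The zeros of $1/\Gamma$ are simple: differentiating $1/\Gamma(s)=s/\Gamma(s+1)$ at a zero
$s=-(n+1)$ leaves only $s$ times the derivative at $-n$, and the derivative at $0$ is
$1/\Gamma(1)=1$. -/
theorem deriv_rGamma_neg_nat_ne_zero (n : ℕ) : deriv rGamma (-n) ≠ 0 := by
  have h (s : ℂ) : deriv rGamma s = rGamma (s + 1) + s * deriv rGamma (s + 1) := by
    have h1 : HasDerivAt (fun s => s * rGamma (s + 1))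
        (1 * rGamma (s + 1) + s * deriv rGamma (s + 1)) s :=
      (hasDerivAt_id s).mul
        ((differentiable_rGamma (s + 1)).hasDerivAt.comp_add_const s 1)
    have h2 : rGamma = fun s => s * rGamma (s + 1) := funext rGamma_eq_mul
    conv_lhs => rw [h2]
    rw [h1.deriv, one_mul]
  induction n with
  | zero =>
    rw [h]
    have : rGamma 1 = 1 := by simpa using rGamma_nat_add_one 0
    simp [this]
  | succ n ih =>
    rw [h]
    have e : (-((n + 1 : ℕ) : ℂ) + 1) = -n := by push_cast; ring
    rw [e, rGamma_neg_nat, zero_add]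
    refine mul_ne_zero ?_ ih
    rw [neg_ne_zero]; exact_mod_cast n.succ_ne_zero

/-- Locally uniformly in `s`, `1/Γ(s+n+1)` decays faster than every geometric sequence. -/
theorem exists_rGamma_bound (M K : ℝ) (hK : 0 < K) :
    ∃ C, 0 ≤ C ∧ ∀ n : ℕ, ∀ s : ℂ, ‖s‖ ≤ M → ‖rGamma (s + n + 1)‖ * K ^ n ≤ C := by
  have hb (n : ℕ) : ∃ C, ∀ s : ℂ, ‖s‖ ≤ M → ‖rGamma (s + n + 1)‖ * K ^ n ≤ C := by
    have hc : ContinuousOn (fun s : ℂ => ‖rGamma (s + n + 1)‖ * K ^ n)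
        (Metric.closedBall 0 M) := by
      have := differentiable_rGamma.continuous
      fun_prop
    obtain ⟨C, hC⟩ := (isCompact_closedBall (0 : ℂ) M).bddAbove_image hc
    exact ⟨C, fun s hs => hC ⟨s, by simpa using hs, rfl⟩⟩
  choose C hC using hb
  -- For $n\ge n_0$ one has $|s+n+1|\ge K$, so the functional equation makes the weighted sequence
  -- nonincreasing from $n_0$ on; finitely many compactness bounds cover the rest.
  obtain ⟨n₀, hn₀⟩ := exists_nat_ge (M + K)
  have hle (n : ℕ) (hn : n ≤ n₀) : C n ≤ ∑ m ∈ Finset.range (n₀ + 1), |C m| :=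
    (le_abs_self _).trans (Finset.single_le_sum (f := fun m => |C m|) (fun _ _ => abs_nonneg _)
      (Finset.mem_range.2 (by omega)))
  refine ⟨∑ m ∈ Finset.range (n₀ + 1), |C m|, by positivity, fun n s hs => ?_⟩
  rcases le_total n n₀ with hn | hn
  · exact (hC n s hs).trans (hle n hn)
  induction n, hn using Nat.le_induction with
  | base => exact (hC n₀ s hs).trans (hle n₀ le_rfl)
  | succ n hn ih =>
    refine le_trans ?_ ih
    have h1 : K ≤ ‖s + n + 1‖ := by
      have h2 : ‖((n : ℂ) + 1)‖ = n + 1 := by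
        have := Complex.norm_natCast (n + 1)
        push_cast at this; exact this
      have h3 : ‖((n : ℂ) + 1)‖ ≤ ‖s + n + 1‖ + ‖s‖ := by
        calc ‖((n : ℂ) + 1)‖ = ‖(s + n + 1) - s‖ := by ring_nf
          _ ≤ _ := norm_sub_le _ _
      have : (n₀ : ℝ) ≤ n := by exact_mod_cast hn
      linarith
    rw [rGamma_eq_mul (s + n + 1), norm_mul]
    push_cast
    rw [← add_assoc, pow_succ]
    have : 0 ≤ ‖rGamma (s + n + 1 + 1)‖ * K ^ n := by positivity
    nlinarith

/-! ### The two-parameter Gamma series and its parameter derivatives. -/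

/-- The bilateral type series `∑ xⁿ / (Γ(b+n+1) Γ(c+n+1))`, which comprises Bessel and Lommel
functions. -/
noncomputable def gammaSeries (x b c : ℂ) : ℂ :=
  ∑' n : ℕ, x ^ n * (rGamma (b + n + 1) * rGamma (c + n + 1))

theorem gammaSeries_comm (x b c : ℂ) : gammaSeries x b c = gammaSeries x c b := by
  simp [gammaSeries, mul_comm (rGamma (b + _ + 1))]

theorem exists_gammaSeries_bound (x : ℂ) (M : ℝ) :
    ∃ u : ℕ → ℝ, Summable u ∧ ∀ n : ℕ, ∀ b c : ℂ, ‖b‖ ≤ M → ‖c‖ ≤ M →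
      ‖x ^ n * (rGamma (b + n + 1) * rGamma (c + n + 1))‖ ≤ u n := by
  obtain ⟨C, hC0, hC⟩ := exists_rGamma_bound M 1 one_pos
  -- The weight $2(\|x\|+1)$ absorbs $\|x\|^n$ and leaves a geometric majorant of ratio $1/2$.
  obtain ⟨D, hD0, hD⟩ := exists_rGamma_bound M (2 * (‖x‖ + 1)) (by positivity)
  refine ⟨fun n => C * D * (1 / 2) ^ n, summable_geometric_two.mul_left _, fun n b c hb hc => ?_⟩
  have h1 := hC n b hb
  have h2 := hD n c hc
  rw [one_pow, mul_one] at h1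
  rw [mul_pow] at h2
  have h3 : ‖x‖ ^ n ≤ (‖x‖ + 1) ^ n := by gcongr; linarith
  have h4 : ‖x‖ ^ n * ‖rGamma (c + n + 1)‖ ≤ D * (1 / 2) ^ n := by
    rw [one_div, inv_pow, ← div_eq_mul_inv, le_div_iff₀ (by positivity)]
    refine le_trans ?_ h2
    calc _ = ‖rGamma (c + n + 1)‖ * (2 ^ n * ‖x‖ ^ n) := by ring
      _ ≤ _ := by gcongr
  rw [norm_mul, norm_mul, norm_pow]
  calc _ = ‖rGamma (b + n + 1)‖ * (‖x‖ ^ n * ‖rGamma (c + n + 1)‖) := by ring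
    _ ≤ C * (D * (1 / 2) ^ n) := by gcongr
    _ = _ := by ring

theorem summable_norm_gammaSeries (x b c : ℂ) :
    Summable fun n : ℕ => ‖x ^ n * (rGamma (b + n + 1) * rGamma (c + n + 1))‖ := by
  obtain ⟨u, hu, h⟩ := exists_gammaSeries_bound x (max ‖b‖ ‖c‖)
  exact Summable.of_nonneg_of_le (fun _ => norm_nonneg _)
    (fun n => h n b c (le_max_left _ _) (le_max_right _ _)) hu

theorem hasSum_gammaSeries (x b c : ℂ) :
    HasSum (fun n : ℕ => x ^ n * (rGamma (b + n + 1) * rGamma (c + n + 1)))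
      (gammaSeries x b c) :=
  (summable_norm_gammaSeries x b c).of_norm.hasSum

/-- Weierstrass' theorem on unit balls, with majorants uniform in the parameters. Working along a
curve covers both uses: $b$ varying alone, and the diagonal $(s+\nu,s)$ on which the Lommel
numerator lives. -/
theorem gammaSeries_curve (x : ℂ) {f g : ℂ → ℂ} (hf : Differentiable ℂ f)
    (hg : Differentiable ℂ g) :
    Differentiable ℂ (fun t => gammaSeries x (f t) (g t)) ∧
    ∀ t, HasSum (fun n : ℕ => x ^ n *
        (deriv rGamma (f t + n + 1) * deriv f t * rGamma (g t + n + 1) +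
          rGamma (f t + n + 1) * (deriv rGamma (g t + n + 1) * deriv g t)))
      (deriv (fun t => gammaSeries x (f t) (g t)) t) := by
  have key (t : ℂ) : ∃ u : ℕ → ℝ, Summable u ∧ ∀ (n : ℕ) (w : ℂ), w ∈ Metric.ball t 1 →
      ‖x ^ n * (rGamma (f w + n + 1) * rGamma (g w + n + 1))‖ ≤ u n := by
    obtain ⟨A, hA⟩ := (isCompact_closedBall t 1).exists_bound_of_continuousOn
      hf.continuous.continuousOn
    obtain ⟨B, hB⟩ := (isCompact_closedBall t 1).exists_bound_of_continuousOn
      hg.continuous.continuousOn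
    obtain ⟨u, hu, h⟩ := exists_gammaSeries_bound x (max A B)
    exact ⟨u, hu, fun n w hw => h n _ _
      ((hA w (Metric.ball_subset_closedBall hw)).trans (le_max_left _ _))
      ((hB w (Metric.ball_subset_closedBall hw)).trans (le_max_right _ _))⟩
  have hd (n : ℕ) (t : ℂ) : HasDerivAt
      (fun w => x ^ n * (rGamma (f w + n + 1) * rGamma (g w + n + 1)))
      (x ^ n * (deriv rGamma (f t + n + 1) * deriv f t * rGamma (g t + n + 1) +
          rGamma (f t + n + 1) * (deriv rGamma (g t + n + 1) * deriv g t))) t := by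
    have h1 {f : ℂ → ℂ} (hf : Differentiable ℂ f) : HasDerivAt (fun w => rGamma (f w + n + 1))
        (deriv rGamma (f t + n + 1) * deriv f t) t :=
      (differentiable_rGamma _).hasDerivAt.comp t
        (((hf t).hasDerivAt.add_const (n : ℂ)).add_const 1)
    exact ((h1 hf).mul (h1 hg)).const_mul _
  constructor
  · intro t
    obtain ⟨u, hu, h⟩ := key t
    exact (Complex.differentiableOn_tsum_of_summable_norm hu
      (fun n w _ => (hd n w).differentiableAt.differentiableWithinAt) Metric.isOpen_ball
      h).differentiableAt (Metric.ball_mem_nhds t one_pos)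
  · intro t
    obtain ⟨u, hu, h⟩ := key t
    have := Complex.hasSum_deriv_of_summable_norm hu
      (fun n w _ => (hd n w).differentiableAt.differentiableWithinAt) Metric.isOpen_ball
      h (Metric.mem_ball_self one_pos)
    simp only [(hd _ t).deriv] at this
    exact this

/-- The derivative of `gammaSeries x b c` in `b`. -/
noncomputable def gammaSeriesDeriv (x b c : ℂ) : ℂ := deriv (fun s => gammaSeries x s c) b

theorem differentiable_gammaSeries (x c : ℂ) : Differentiable ℂ fun s => gammaSeries x s c :=
  (gammaSeries_curve x differentiable_id (differentiable_const c)).1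

theorem hasDerivAt_gammaSeries (x b c : ℂ) :
    HasDerivAt (fun s => gammaSeries x s c) (gammaSeriesDeriv x b c) b :=
  (differentiable_gammaSeries x c b).hasDerivAt

theorem hasSum_gammaSeriesDeriv (x b c : ℂ) :
    HasSum (fun n : ℕ => x ^ n * (deriv rGamma (b + n + 1) * rGamma (c + n + 1)))
      (gammaSeriesDeriv x b c) := by
  simpa [gammaSeriesDeriv] using
    (gammaSeries_curve x differentiable_id (differentiable_const c)).2 b

theorem hasDerivAt_gammaSeries_diagonal (x ν c : ℂ) :
    HasDerivAt (fun s => gammaSeries x (s + ν) s)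
      (gammaSeriesDeriv x (c + ν) c + gammaSeriesDeriv x c (c + ν)) c := by
  have hd : Differentiable ℂ fun s : ℂ => s + ν := by fun_prop
  obtain ⟨h1, h2⟩ := gammaSeries_curve x hd differentiable_id
  have h3 := (h1 c).hasDerivAt
  have h4 := h2 c
  have h5 := (hasSum_gammaSeriesDeriv x (c + ν) c).add (hasSum_gammaSeriesDeriv x c (c + ν))
  refine h3.congr_deriv (h4.unique ?_)
  convert h5 using 2
  simp; ring

theorem gammaSeries_shift (x b c : ℂ) :
    gammaSeries x b c = rGamma (b + 1) * rGamma (c + 1) + x * gammaSeries x (b + 1) (c + 1) := by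
  have h := (hasSum_gammaSeries x b c).summable.tsum_eq_zero_add
  rw [gammaSeries, h, gammaSeries, ← tsum_mul_left]
  simp only [pow_zero, Nat.cast_zero, add_zero, one_mul]
  congr 2
  ext n
  rw [pow_succ]; push_cast
  rw [show b + 1 + (n : ℂ) = b + (n + 1) by ring, show c + 1 + (n : ℂ) = c + (n + 1) by ring]
  ring

/-- The first $p$ summands vanish because $1/\Gamma$ is zero at the nonpositive integers; what
remains is a reindexed Bessel series. -/
theorem gammaSeries_neg_nat (x b : ℂ) (p : ℕ) :
    gammaSeries x b (-p) = x ^ p * gammaSeries x (b + p) 0 := by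
  induction p generalizing b with
  | zero => simp
  | succ p ih =>
    have e : (-((p + 1 : ℕ) : ℂ) + 1) = -p := by push_cast; ring
    rw [gammaSeries_shift, e, rGamma_neg_nat, ih, mul_zero, zero_add]
    push_cast
    rw [show b + 1 + (p : ℂ) = b + (p + 1) by ring]
    ring

theorem gammaSeriesDeriv_neg_nat (x b : ℂ) (p : ℕ) :
    gammaSeriesDeriv x b (-p) = x ^ p * gammaSeriesDeriv x (b + p) 0 := by
  simp only [gammaSeriesDeriv, gammaSeries_neg_nat]
  exact (((hasDerivAt_gammaSeries x (b + p) 0).comp_add_const b (p : ℂ)).const_mul _).deriv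

/-! ### Bessel functions of the first kind as functions of the order. -/

/-- The Bessel function `J_ν(2h)` for complex order. -/
noncomputable def cBesselJ (h : ℝ) (ν : ℂ) : ℂ := (h : ℂ) ^ ν * gammaSeries (-(h : ℂ) ^ 2) ν 0

theorem hasDerivAt_cBesselJ {h : ℝ} (hh : 0 < h) (ν : ℂ) :
    HasDerivAt (cBesselJ h) ((h : ℂ) ^ ν * (Complex.log h * gammaSeries (-(h : ℂ) ^ 2) ν 0 +
      gammaSeriesDeriv (-(h : ℂ) ^ 2) ν 0)) ν := by
  have h0 : (h : ℂ) ≠ 0 := by exact_mod_cast hh.ne'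
  have h1 := (HasStrictDerivAt.const_cpow (c := (h : ℂ)) (hasStrictDerivAt_id ν)
    (Or.inl h0)).hasDerivAt.mul (hasDerivAt_gammaSeries (-(h : ℂ) ^ 2) ν 0)
  refine h1.congr_deriv ?_
  simp; ring

theorem cpow_add_natCast_eq {h : ℝ} (hh : 0 < h) (b : ℂ) (p : ℕ) :
    (h : ℂ) ^ (b + p) = (h : ℂ) ^ (b + -p) * ((h : ℂ) ^ 2) ^ p := by
  have h0 : (h : ℂ) ≠ 0 := by exact_mod_cast hh.ne'
  rw [← pow_mul, ← Complex.cpow_natCast, ← Complex.cpow_add _ _ h0]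
  congr 1
  push_cast
  ring

theorem cpow_mul_gammaSeries_left {h : ℝ} (hh : 0 < h) (b : ℂ) (p : ℕ) :
    (h : ℂ) ^ (b + -p) * gammaSeries (-(h : ℂ) ^ 2) b (-p) =
      (-1) ^ p * cBesselJ h (b + p) := by
  rw [gammaSeries_neg_nat, cBesselJ, cpow_add_natCast_eq hh, ← neg_one_mul ((h : ℂ) ^ 2), mul_pow]
  ring

theorem cpow_mul_gammaSeriesDeriv_left {h : ℝ} (hh : 0 < h) (b : ℂ) (p : ℕ) :
    (h : ℂ) ^ (b + -p) * gammaSeriesDeriv (-(h : ℂ) ^ 2) b (-p) =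
      (-1) ^ p * ((h : ℂ) ^ (b + p) * gammaSeriesDeriv (-(h : ℂ) ^ 2) (b + p) 0) := by
  rw [gammaSeriesDeriv_neg_nat, cpow_add_natCast_eq hh, ← neg_one_mul ((h : ℂ) ^ 2), mul_pow]
  ring

/-- This is $J_{-n}=(-1)^nJ_n$ with $n=q-p$: the series with parameters $(-q,-p)$ is symmetric, and
either parameter can be reduced to $0$. Writing integers as differences of naturals avoids splitting
by sign. -/
theorem cBesselJ_sub_nat {h : ℝ} (hh : 0 < h) (p q : ℕ) :
    (-1) ^ p * cBesselJ h (p - q) = (-1) ^ q * cBesselJ h (q - p) := by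
  have h1 := cpow_mul_gammaSeries_left hh (-q) p
  have h2 := cpow_mul_gammaSeries_left hh (-p) q
  rw [gammaSeries_comm, add_comm (-(p : ℂ)), h1] at h2
  rw [show (p : ℂ) - q = -q + p by ring, show (q : ℂ) - p = -p + q by ring, h2]

/-! ### Removable quotients, and the function Y at integral order. -/

theorem tendsto_div_of_hasDerivAt {f g : ℂ → ℂ} {a f' g' : ℂ} (hf : HasDerivAt f f' a)
    (hg : HasDerivAt g g' a) (hf0 : f a = 0) (hg0 : g a = 0) (hg' : g' ≠ 0) :
    Tendsto (fun t => f t / g t) (𝓝[≠] a) (𝓝 (f' / g')) := by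
  refine ((hf.tendsto_slope.div hg.tendsto_slope hg')).congr' ?_
  filter_upwards [self_mem_nhdsWithin] with t ht
  have : t - a ≠ 0 := sub_ne_zero.2 ht
  simp only [slope_def_field, hf0, hg0, sub_zero, Pi.div_apply]
  field_simp

/-- Each denominator factor has at most a simple zero at $a$, so it suffices that $U$ vanish to the
total order. If both factors vanish, one zero of $U$ is split off as $t-a$ by `dslope` and
l'Hôpital's rule is applied twice. -/
theorem exists_tendsto_div_mul {U g₁ g₂ : ℂ → ℂ} (hU : Differentiable ℂ U)
    (h₁ : Differentiable ℂ g₁) (h₂ : Differentiable ℂ g₂) (a : ℂ)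
    (h₁' : g₁ a = 0 → deriv g₁ a ≠ 0) (h₂' : g₂ a = 0 → deriv g₂ a ≠ 0)
    (hU0 : g₁ a = 0 ∨ g₂ a = 0 → U a = 0) (hU1 : g₁ a = 0 → g₂ a = 0 → deriv U a = 0) :
    ∃ L, Tendsto (fun t => U t / (g₁ t * g₂ t)) (𝓝[≠] a) (𝓝 L) := by
  have hc {f : ℂ → ℂ} (hf : Differentiable ℂ f) : Tendsto f (𝓝[≠] a) (𝓝 (f a)) :=
    hf.continuous.continuousAt.tendsto.mono_left nhdsWithin_le_nhds
  by_cases z₁ : g₁ a = 0 <;> by_cases z₂ : g₂ a = 0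
  · have hV : Differentiable ℂ (dslope U a) := by
      rw [← differentiableOn_univ, Complex.differentiableOn_dslope univ_mem]
      exact hU.differentiableOn
    have hV0 : dslope U a a = 0 := by rw [dslope_same, hU1 z₁ z₂]
    have t₂ := tendsto_div_of_hasDerivAt (hV a).hasDerivAt (h₂ a).hasDerivAt hV0 z₂ (h₂' z₂)
    have t₁ := tendsto_div_of_hasDerivAt ((hasDerivAt_id a).sub_const a) (h₁ a).hasDerivAt
      (sub_self a) z₁ (h₁' z₁)
    refine ⟨_, (t₁.mul t₂).congr fun t => ?_⟩
    have : U t = (t - a) * dslope U a t := by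
      have := sub_smul_dslope U a t
      rw [hU0 (Or.inl z₁), sub_zero, smul_eq_mul] at this
      exact this.symm
    rw [this, id, div_mul_div_comm]
  · have t₁ := tendsto_div_of_hasDerivAt (hU a).hasDerivAt (h₁ a).hasDerivAt (hU0 (Or.inl z₁)) z₁
      (h₁' z₁)
    exact ⟨_, (t₁.div (hc h₂) z₂).congr fun t => by rw [Pi.div_apply, div_div]⟩
  · have t₁ := tendsto_div_of_hasDerivAt (hU a).hasDerivAt (h₂ a).hasDerivAt (hU0 (Or.inr z₂)) z₂
      (h₂' z₂)
    exact ⟨_, (t₁.div (hc h₁) z₁).congr fun t => by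
      rw [Pi.div_apply, div_div, mul_comm (g₂ t)]⟩
  · exact ⟨_, (hc hU).div ((hc h₁).mul (hc h₂)) (mul_ne_zero z₁ z₂)⟩

theorem besselJ_ofReal {z : ℝ} (hz : 0 < z) (ν : ℝ) :
    (besselJ ν z : ℂ) = cBesselJ (z / 2) ν := by
  rw [besselJ, cBesselJ, gammaSeries, Complex.ofReal_mul, Complex.ofReal_cpow (by positivity),
    Complex.ofReal_tsum]
  congr 2
  ext n
  have e1 : rGamma ((ν : ℂ) + n + 1) = ((Real.Gamma (ν + n + 1))⁻¹ : ℝ) := by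
    rw [← rGamma_ofReal]; push_cast; rfl
  rw [zero_add, rGamma_nat_add_one, e1]
  push_cast
  rw [show -((z : ℂ) / 2) ^ 2 = -(z : ℂ) ^ 2 / 4 by ring]
  ring

theorem tendsto_ofReal_punctured (a : ℝ) :
    Tendsto (fun w : ℝ => (w : ℂ)) (𝓝[≠] a) (𝓝[≠] (a : ℂ)) :=
  tendsto_nhdsWithin_of_tendsto_nhds_of_eventually_within _
    (Complex.continuous_ofReal.continuousAt.tendsto.mono_left nhdsWithin_le_nhds)
    (by filter_upwards [self_mem_nhdsWithin] with w hw
        simpa using hw)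

theorem tendsto_of_tendsto_ofReal {l : Filter ℝ} {f : ℝ → ℝ} {L : ℂ}
    (h : Tendsto (fun w => (f w : ℂ)) l (𝓝 L)) : Tendsto f l (𝓝 L.re) := by
  simpa [Function.comp_def] using (Complex.continuous_re.tendsto L).comp h

theorem complex_cos_nat_mul_pi (n : ℕ) : Complex.cos (n * Real.pi) = (-1) ^ n := by
  have := Real.cos_nat_mul_pi n
  exact_mod_cast congrArg (fun x : ℝ => (x : ℂ)) this

theorem cos_nat_sub_nat_mul_pi (p q : ℕ) :
    Complex.cos (((p : ℂ) - q) * Real.pi) = (-1) ^ p * (-1) ^ q := by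
  rw [sub_mul, Complex.cos_sub, Complex.sin_nat_mul_pi, complex_cos_nat_mul_pi,
    complex_cos_nat_mul_pi]
  ring

theorem sin_nat_sub_nat_mul_pi (p q : ℕ) :
    Complex.sin (((p : ℂ) - q) * Real.pi) = 0 := by
  rw [sub_mul, Complex.sin_sub, Complex.sin_nat_mul_pi, Complex.sin_nat_mul_pi]
  ring

theorem neg_one_pow_mul_self_complex (p : ℕ) : ((-1 : ℂ) ^ p) * (-1) ^ p = 1 := by
  rw [← mul_pow]; simp

/-- At integral order `p - q`, the function `Y` is the limit of the defining quotient, given by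
the derivatives of `J` in the order. -/
theorem tendsto_besselYGeneric_int {z : ℝ} (hz : 0 < z) (p q : ℕ) :
    Tendsto (fun w => besselYGeneric w z) (𝓝[≠] ((p : ℝ) - q)) (𝓝 (besselY (p - q) z)) ∧
    Real.pi * (besselY (p - q) z : ℂ) = deriv (cBesselJ (z / 2)) (p - q) +
      (-1) ^ p * (-1) ^ q * deriv (cBesselJ (z / 2)) (q - p) := by
  set h := z / 2 with hh
  have hpos : 0 < h := by positivity
  set N : ℂ := (p : ℂ) - q with hN
  have hN' : -N = (q : ℂ) - p := by rw [hN]; ring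
  have hd (ν : ℂ) : HasDerivAt (cBesselJ h) (deriv (cBesselJ h) ν) ν :=
    (hasDerivAt_cBesselJ hpos ν).differentiableAt.hasDerivAt
  have hlin : HasDerivAt (fun w : ℂ => w * Real.pi) (Real.pi : ℂ) N := by
    simpa using (hasDerivAt_id N).mul_const (Real.pi : ℂ)
  have hneg : HasDerivAt (fun w : ℂ => cBesselJ h (-w)) (-deriv (cBesselJ h) (-N)) N := by
    simpa [Function.comp_def] using (hd (-N)).comp N (hasDerivAt_neg N)
  have hnum : HasDerivAt (fun w => cBesselJ h w * Complex.cos (w * Real.pi) - cBesselJ h (-w))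
      ((-1) ^ p * (-1) ^ q * deriv (cBesselJ h) N + deriv (cBesselJ h) (-N)) N := by
    refine (((hd N).mul hlin.ccos).sub hneg).congr_deriv ?_
    rw [hN, sin_nat_sub_nat_mul_pi, cos_nat_sub_nat_mul_pi]
    ring
  have hden : HasDerivAt (fun w : ℂ => Complex.sin (w * Real.pi))
      ((-1) ^ p * (-1) ^ q * Real.pi) N := by
    refine hlin.csin.congr_deriv ?_
    rw [hN, cos_nat_sub_nat_mul_pi]
  have hpi : (Real.pi : ℂ) ≠ 0 := by exact_mod_cast Real.pi_ne_zero
  have h1 := neg_one_pow_mul_self_complex p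
  have h2 := neg_one_pow_mul_self_complex q
  -- Numerator and denominator both vanish at $N=p-q$, the former by $J_{-N}=(-1)^NJ_N$.
  have hlim := tendsto_div_of_hasDerivAt hnum hden
    (by
      rw [hN', hN, cos_nat_sub_nat_mul_pi]
      have := cBesselJ_sub_nat hpos p q
      linear_combination (-1) ^ q * this + cBesselJ h (q - p) * h2)
    (by rw [hN, sin_nat_sub_nat_mul_pi])
    (mul_ne_zero (mul_ne_zero (left_ne_zero_of_mul_eq_one h1) (left_ne_zero_of_mul_eq_one h2)) hpi)
  have hcast : ((((p : ℝ) - q : ℝ)) : ℂ) = N := by rw [hN]; push_cast; rfl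
  have hlim' := hlim.comp (hcast ▸ tendsto_ofReal_punctured ((p : ℝ) - q))
  have hlim2 : Tendsto (fun w : ℝ => (besselYGeneric w z : ℂ)) (𝓝[≠] ((p : ℝ) - q))
      (𝓝 (((-1) ^ p * (-1) ^ q * deriv (cBesselJ h) N + deriv (cBesselJ h) (-N)) /
        ((-1) ^ p * (-1) ^ q * Real.pi))) := by
    refine hlim'.congr fun w => ?_
    rw [besselYGeneric]
    push_cast [besselJ_ofReal hz]
    rfl
  have hre := tendsto_of_tendsto_ofReal hlim2
  have hY : besselY (p - q) z = (((-1) ^ p * (-1) ^ q * deriv (cBesselJ h) N +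
      deriv (cBesselJ h) (-N)) / ((-1) ^ p * (-1) ^ q * (Real.pi : ℂ))).re := by
    rw [besselY, if_pos ⟨(p : ℤ) - q, by push_cast; rfl⟩]
    exact hre.limUnder_eq
  have hYc := tendsto_nhds_unique hlim2
    ((Complex.continuous_ofReal.tendsto _).comp hre)
  rw [← hY] at hre hYc
  refine ⟨hre, ?_⟩
  rw [← hYc, ← hN', mul_div_assoc', div_eq_iff
    (mul_ne_zero (mul_ne_zero (left_ne_zero_of_mul_eq_one h1) (left_ne_zero_of_mul_eq_one h2)) hpi)]
  linear_combination -Real.pi * deriv (cBesselJ h) (-N) * ((-1) ^ q * (-1) ^ q * h1 + h2)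

theorem besselY_of_not_int {ν : ℝ} (hν : ¬∃ n : ℤ, ν = n) (z : ℝ) :
    besselY ν z = besselYGeneric ν z := by
  rw [besselY, if_neg hν]

/-! ### The Lommel function as a quotient of entire functions, and its continuity in μ. -/

/-- The entire function of `c` whose quotient by `1 / (Γ(c+ν) Γ(c))` is, up to a power of `2`, the
Lommel function `S_{2c+ν-1,ν}(z)`. -/
noncomputable def lommelNumerator (ν z : ℝ) (c : ℂ) : ℂ :=
  ((z / 2 : ℝ) : ℂ) ^ (c + ν + c) * gammaSeries (-((z / 2 : ℝ) : ℂ) ^ 2) (c + ν) c -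
    Complex.cos (c * Real.pi) * besselJ ν z - Complex.sin (c * Real.pi) * besselY ν z

theorem hasDerivAt_lommelNumerator {z : ℝ} (hz : 0 < z) (ν : ℝ) (c : ℂ) :
    HasDerivAt (lommelNumerator ν z)
      (((z / 2 : ℝ) : ℂ) ^ (c + ν + c) * (2 * Complex.log ((z / 2 : ℝ) : ℂ) *
          gammaSeries (-((z / 2 : ℝ) : ℂ) ^ 2) (c + ν) c +
        (gammaSeriesDeriv (-((z / 2 : ℝ) : ℂ) ^ 2) (c + ν) c +
          gammaSeriesDeriv (-((z / 2 : ℝ) : ℂ) ^ 2) c (c + ν))) +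
        Real.pi * (Complex.sin (c * Real.pi) * besselJ ν z -
          Complex.cos (c * Real.pi) * besselY ν z)) c := by
  have h0 : ((z / 2 : ℝ) : ℂ) ≠ 0 := by exact_mod_cast (by positivity : z / 2 ≠ 0)
  have hlin : HasDerivAt (fun w : ℂ => w * Real.pi) (Real.pi : ℂ) c := by
    simpa using (hasDerivAt_id c).mul_const (Real.pi : ℂ)
  have hexp : HasDerivAt (fun c : ℂ => c + ν + c) 2 c :=
    (((hasDerivAt_id c).add_const (ν : ℂ)).add (hasDerivAt_id c)).congr_deriv (by norm_num)
  have h1 := (hexp.const_cpow (Or.inl h0)).mul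
    (hasDerivAt_gammaSeries_diagonal (-((z / 2 : ℝ) : ℂ) ^ 2) ν c)
  refine ((h1.sub (hlin.ccos.mul_const (besselJ ν z : ℂ))).sub
    (hlin.csin.mul_const (besselY ν z : ℂ))).congr_deriv ?_
  ring

/-- At $c=-p$ the series part collapses to $(-1)^pJ_\nu$, which the cosine term cancels, and the
sine vanishes. -/
theorem lommelNumerator_neg_nat {z : ℝ} (hz : 0 < z) (ν : ℝ) (p : ℕ) :
    lommelNumerator ν z (-p) = 0 := by
  have h := cpow_mul_gammaSeries_left (show 0 < z / 2 by positivity) (-(p : ℂ) + ν) p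
  have h2 := neg_one_pow_mul_self_complex p
  have hc := cos_nat_sub_nat_mul_pi 0 p
  have hs := sin_nat_sub_nat_mul_pi 0 p
  simp only [Nat.cast_zero, zero_sub, pow_zero, one_mul] at hc hs
  rw [lommelNumerator, h, besselJ_ofReal hz, hc, hs, show -(p : ℂ) + ν + p = ν by ring]
  ring

/-- Here $c+\nu=-q$ and the series part collapses to $(-1)^qJ_{-\nu}$. For nonintegral $\nu$ the
defining quotient of $Y_\nu$ cancels it; for integral $\nu$ the sine vanishes and $J_{-n}=(-1)^nJ_n$
does. -/
theorem lommelNumerator_sub_nat {z : ℝ} (hz : 0 < z) (ν : ℝ) (q : ℕ) :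
    lommelNumerator ν z (-ν - q) = 0 := by
  have hpos : 0 < z / 2 := by positivity
  by_cases hν : ∃ n : ℤ, ν = n
  · obtain ⟨n, hn⟩ := hν
    rcases le_or_gt (-(q : ℤ)) n with hle | hlt
    · obtain ⟨p, hp⟩ := Int.eq_ofNat_of_zero_le (show 0 ≤ n + q by omega)
      have : (-(ν : ℂ) - q) = -(p : ℂ) := by
        rw [hn]
        have : ((n + q : ℤ) : ℂ) = p := by rw [hp]; rfl
        push_cast at this ⊢
        linear_combination -this
      rw [this, lommelNumerator_neg_nat hz]
    · obtain ⟨m, hm⟩ := Int.eq_ofNat_of_zero_le (show 0 ≤ -n - q by omega)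
      have hm' : (-(ν : ℂ) - q) = m := by
        rw [hn]
        have : ((-n - q : ℤ) : ℂ) = m := by rw [hm]; rfl
        push_cast at this ⊢
        exact this
      have hν' : (ν : ℂ) = -m - q := by linear_combination -hm'
      have h := cpow_mul_gammaSeries_left hpos m q
      have hJ := cBesselJ_sub_nat hpos 0 (m + q)
      have h2 := neg_one_pow_mul_self_complex q
      have h3 := neg_one_pow_mul_self_complex m
      push_cast at hJ
      rw [lommelNumerator, hm', besselJ_ofReal hz, complex_cos_nat_mul_pi, Complex.sin_nat_mul_pi,
        hν', show (m : ℂ) + (-m - q) = -q by ring, gammaSeries_comm,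
        show -(q : ℂ) + m = m + -q by ring, h]
      rw [show (0 : ℂ) - (m + q) = -m - q by ring, pow_zero, one_mul, sub_zero] at hJ
      rw [hJ, pow_add]
      linear_combination -(-1) ^ q * cBesselJ (z / 2) (m + q) * h3
  · have hsin : Complex.sin (ν * Real.pi) ≠ 0 := by
      rw [Complex.sin_ne_zero_iff]
      intro n hn
      refine hν ⟨n, ?_⟩
      have hpi : (Real.pi : ℂ) ≠ 0 := by exact_mod_cast Real.pi_ne_zero
      exact_mod_cast mul_right_cancel₀ hpi hn
    have h := cpow_mul_gammaSeries_left hpos (-ν - q) q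
    have hY : (besselY ν z : ℂ) = (besselJ ν z * Complex.cos (ν * Real.pi) - besselJ (-ν) z) /
        Complex.sin (ν * Real.pi) := by
      rw [besselY_of_not_int hν, besselYGeneric]; push_cast; rfl
    have hc : Complex.cos ((-(ν : ℂ) - q) * Real.pi) = (-1) ^ q * Complex.cos (ν * Real.pi) := by
      rw [sub_mul, Complex.cos_sub, complex_cos_nat_mul_pi, Complex.sin_nat_mul_pi, neg_mul,
        Complex.cos_neg]
      ring
    have hs : Complex.sin ((-(ν : ℂ) - q) * Real.pi) =
        -((-1) ^ q * Complex.sin (ν * Real.pi)) := by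
      rw [sub_mul, Complex.sin_sub, complex_cos_nat_mul_pi, Complex.sin_nat_mul_pi, neg_mul,
        Complex.sin_neg]
      ring
    have e : -(ν : ℂ) - q + q = -ν := by ring
    rw [e] at h
    rw [lommelNumerator, show -(ν : ℂ) - q + ν = -q by ring, gammaSeries_comm,
      show -(q : ℂ) + (-ν - q) = -ν - q + -q by ring, h, hY, hc, hs, besselJ_ofReal hz (-ν)]
    push_cast
    field_simp
    ring

/-- For $\nu=p-q$ both $c=-p$ and $c+\nu=-q$ are zeros of $1/\Gamma$, so a double zero of the
numerator is needed. The two order derivatives coming from the series are exactly those in the limit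
formula for $\pi Y_{p-q}$. -/
theorem deriv_lommelNumerator_neg_nat {z : ℝ} (hz : 0 < z) (p q : ℕ) :
    deriv (lommelNumerator (p - q) z) (-p) = 0 := by
  have hpos : 0 < z / 2 := by positivity
  have hY := (tendsto_besselYGeneric_int hz p q).2
  have h1 := cpow_mul_gammaSeriesDeriv_left hpos (-q) p
  have h2 := cpow_mul_gammaSeriesDeriv_left hpos (-p) q
  have h3 := cpow_mul_gammaSeries_left hpos (-q) p
  have hJ := cBesselJ_sub_nat hpos p q
  have sp := neg_one_pow_mul_self_complex p
  have sq := neg_one_pow_mul_self_complex q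
  have hc := cos_nat_sub_nat_mul_pi 0 p
  have hs := sin_nat_sub_nat_mul_pi 0 p
  simp only [Nat.cast_zero, zero_sub, pow_zero, one_mul] at hc hs
  rw [(hasDerivAt_lommelNumerator hz _ _).deriv, hc, hs]
  rw [(hasDerivAt_cBesselJ hpos _).deriv, (hasDerivAt_cBesselJ hpos _).deriv] at hY
  push_cast
  push_cast at hY h1 h2 h3 hJ
  rw [show -(p : ℂ) + (p - q) = -q by ring, show -(q : ℂ) + -p = -p + -q by ring] at *
  rw [show -(q : ℂ) + p = p - q by ring] at h1 h3
  rw [show -(p : ℂ) + q = q - p by ring] at h2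
  rw [cBesselJ, cBesselJ] at hJ
  rw [cBesselJ] at h3
  push_cast at hJ h3
  linear_combination 2 * Complex.log ((z : ℂ) / 2) * h3 + h1 + h2 - (-1) ^ p * hY +
    Complex.log ((z : ℂ) / 2) * hJ - (-1) ^ q * (((z : ℂ) / 2) ^ ((q : ℂ) - p) *
      (Complex.log (z / 2) * gammaSeries (-((z : ℂ) / 2) ^ 2) (q - p) 0 +
        gammaSeriesDeriv (-((z : ℂ) / 2) ^ 2) (q - p) 0)) * sp

theorem differentiable_lommelNumerator {z : ℝ} (hz : 0 < z) (ν : ℝ) :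
    Differentiable ℂ (lommelNumerator ν z) :=
  fun c => (hasDerivAt_lommelNumerator hz ν c).differentiableAt

theorem differentiable_rGamma_add (ν : ℂ) : Differentiable ℂ fun c => rGamma (c + ν) :=
  differentiable_rGamma.comp (differentiable_id.add_const ν)

theorem deriv_rGamma_ne_zero {s : ℂ} (hs : rGamma s = 0) : deriv rGamma s ≠ 0 := by
  obtain ⟨n, rfl⟩ := (rGamma_eq_zero_iff s).1 hs
  exact deriv_rGamma_neg_nat_ne_zero n

theorem deriv_rGamma_add_ne_zero {s ν : ℂ} (hs : rGamma (s + ν) = 0) :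
    deriv (fun c => rGamma (c + ν)) s ≠ 0 := by
  rw [deriv_comp_add_const]
  exact deriv_rGamma_ne_zero hs

theorem exists_tendsto_lommelNumerator_div {z : ℝ} (hz : 0 < z) (ν : ℝ) (a : ℂ) :
    ∃ L, Tendsto (fun c => lommelNumerator ν z c / (rGamma (c + ν) * rGamma c)) (𝓝[≠] a)
      (𝓝 L) := by
  refine exists_tendsto_div_mul (differentiable_lommelNumerator hz ν)
    (differentiable_rGamma_add ν) differentiable_rGamma a
    deriv_rGamma_add_ne_zero deriv_rGamma_ne_zero ?_ ?_
  · rintro (h | h)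
    · obtain ⟨q, hq⟩ := (rGamma_eq_zero_iff _).1 h
      rw [show a = -ν - q by linear_combination hq, lommelNumerator_sub_nat hz]
    · obtain ⟨p, hp⟩ := (rGamma_eq_zero_iff _).1 h
      rw [hp, lommelNumerator_neg_nat hz]
  · intro h₁ h₂
    obtain ⟨q, hq⟩ := (rGamma_eq_zero_iff _).1 h₁
    obtain ⟨p, hp⟩ := (rGamma_eq_zero_iff _).1 h₂
    have hν : ν = p - q := by
      have : (ν : ℂ) = p - q := by linear_combination hq - hp
      exact_mod_cast this
    rw [hp, hν, deriv_lommelNumerator_neg_nat hz]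

theorem eventually_rGamma_ne_zero (ν a : ℂ) :
    ∀ᶠ c in 𝓝[≠] a, rGamma (c + ν) * rGamma c ≠ 0 := by
  have key {g : ℂ → ℂ} (hg : Differentiable ℂ g) (hg' : g a = 0 → deriv g a ≠ 0) :
      ∀ᶠ c in 𝓝[≠] a, g c ≠ 0 := by
    by_cases h : g a = 0
    · exact (hg a).hasDerivAt.eventually_ne (hg' h)
    · exact (hg.continuous.continuousAt.eventually_ne h).filter_mono nhdsWithin_le_nhds
  filter_upwards [key (differentiable_rGamma_add ν) deriv_rGamma_add_ne_zero,
    key differentiable_rGamma deriv_rGamma_ne_zero] with c h₁ h₂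
  exact mul_ne_zero h₁ h₂

theorem rGamma_eq_prod_mul (s : ℂ) (n : ℕ) :
    rGamma s = (∏ m ∈ Finset.Icc 1 n, (s + m - 1)) * rGamma (s + n) := by
  induction n with
  | zero => simp
  | succ n ih =>
    rw [ih, Finset.prod_Icc_succ_top (by omega), rGamma_eq_mul (s + n)]
    push_cast
    ring_nf

/-- Each factor is a difference of squares, $4(c+\nu+m-1)(c+m-1)$; the two resulting products are
ratios of Gamma values. -/
theorem lommel_prod_eq (μ ν c : ℂ) (hc : c = (μ - ν + 1) / 2) (n : ℕ) :
    ∏ m ∈ Finset.Icc 1 n, ((μ + 2 * (m : ℂ) - 1) ^ 2 - ν ^ 2) =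
      4 ^ n * ((∏ m ∈ Finset.Icc 1 n, (c + ν + m - 1)) * ∏ m ∈ Finset.Icc 1 n, (c + m - 1)) := by
  rw [← Finset.prod_mul_distrib, show (4 : ℂ) ^ n = ∏ m ∈ Finset.Icc 1 n, (4 : ℂ) by simp,
    ← Finset.prod_mul_distrib]
  refine Finset.prod_congr rfl fun m _ => ?_
  rw [hc]
  ring

/-- The argument `c = (μ - ν + 1)/2` of the Gamma function in the Lommel function. -/
noncomputable def lommelParam (μ ν : ℝ) : ℂ := ((μ : ℂ) - ν + 1) / 2

theorem lommelSmall_eq {z : ℝ} (hz : 0 < z) (μ ν : ℝ)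
    (h : rGamma (lommelParam μ ν + ν) * rGamma (lommelParam μ ν) ≠ 0) :
    (lommelSmall μ ν z : ℂ) = ((2 ^ (μ - 1) : ℝ) : ℂ) *
      (((z / 2 : ℝ) : ℂ) ^ (lommelParam μ ν + ν + lommelParam μ ν) *
        gammaSeries (-((z / 2 : ℝ) : ℂ) ^ 2) (lommelParam μ ν + ν) (lommelParam μ ν) /
        (rGamma (lommelParam μ ν + ν) * rGamma (lommelParam μ ν))) := by
  set c := lommelParam μ ν with hc
  -- The factor $4$ is consumed by $4^{n+1}$ in the denominator, since the product there has $n+1$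
  -- factors.
  have hpow : (z ^ (μ + 1) : ℝ) = 4 * (2 ^ (μ - 1) * (z / 2) ^ (μ + 1)) := by
    rw [Real.div_rpow hz.le two_pos.le, Real.rpow_sub_one two_ne_zero,
      Real.rpow_add_one two_ne_zero]
    have : (2 : ℝ) ^ μ ≠ 0 := by positivity
    field_simp
    norm_num
  have hexp : ((z / 2 : ℝ) : ℂ) ^ (c + ν + c) = (((z / 2) ^ (μ + 1) : ℝ) : ℂ) := by
    rw [Complex.ofReal_cpow (by positivity)]
    congr 1
    rw [hc, lommelParam]; push_cast; ring
  rw [lommelSmall, hpow, hexp, gammaSeries, Complex.ofReal_mul, Complex.ofReal_tsum, mul_div_assoc,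
    ← tsum_div_const]
  have : ∑' n : ℕ, (((-1) ^ n * z ^ (2 * n) /
      ∏ m ∈ Finset.Icc 1 (n + 1), ((μ + 2 * (m : ℝ) - 1) ^ 2 - ν ^ 2) : ℝ) : ℂ) =
      4⁻¹ * ∑' n : ℕ, (-((z / 2 : ℝ) : ℂ) ^ 2) ^ n * (rGamma (c + ν + n + 1) * rGamma (c + n + 1)) /
        (rGamma (c + ν) * rGamma c) := by
    rw [← tsum_mul_left]
    congr 1
    ext n
    push_cast
    rw [lommel_prod_eq μ ν c rfl]
    have h₁ := rGamma_eq_prod_mul (c + ν) (n + 1)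
    have h₂ := rGamma_eq_prod_mul c (n + 1)
    push_cast at h₁ h₂
    rw [← add_assoc] at h₁ h₂
    rw [h₁, h₂] at h ⊢
    have hA := left_ne_zero_of_mul (left_ne_zero_of_mul h)
    have hB := left_ne_zero_of_mul (right_ne_zero_of_mul h)
    have hC := right_ne_zero_of_mul (left_ne_zero_of_mul h)
    have hD := right_ne_zero_of_mul (right_ne_zero_of_mul h)
    rw [show (-((z : ℂ) / 2) ^ 2) ^ n = (-1) ^ n * z ^ (2 * n) / 4 ^ n by
      rw [← neg_one_mul, mul_pow, div_pow, div_pow, ← pow_mul]; norm_num [mul_div_assoc]]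
    field_simp
    ring
  rw [this]
  push_cast
  ring

theorem lommelSGeneric_eq {z : ℝ} (hz : 0 < z) (μ ν : ℝ)
    (h : rGamma (lommelParam μ ν + ν) * rGamma (lommelParam μ ν) ≠ 0) :
    (lommelSGeneric μ ν z : ℂ) = ((2 ^ (μ - 1) : ℝ) : ℂ) *
      (lommelNumerator ν z (lommelParam μ ν) /
        (rGamma (lommelParam μ ν + ν) * rGamma (lommelParam μ ν))) := by
  have hG₁ : (Real.Gamma ((μ + ν + 1) / 2) : ℂ) = (rGamma (lommelParam μ ν + ν))⁻¹ := by
    rw [rGamma, inv_inv, ← Complex.Gamma_ofReal, lommelParam]; push_cast; congr 1; ring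
  have hG₂ : (Real.Gamma ((μ - ν + 1) / 2) : ℂ) = (rGamma (lommelParam μ ν))⁻¹ := by
    rw [rGamma, inv_inv, ← Complex.Gamma_ofReal, lommelParam]; push_cast; congr 1
  -- The quarter-period shift turns the sine into $-\cos(c\pi)$ and the cosine into $\sin(c\pi)$.
  have hang : ((μ : ℂ) - ν) * Real.pi / 2 = lommelParam μ ν * Real.pi - Real.pi / 2 := by
    rw [lommelParam]; ring
  rw [lommelSGeneric, Complex.ofReal_add, lommelSmall_eq hz μ ν h]
  simp only [Complex.ofReal_mul, hG₁, hG₂, Complex.ofReal_sub, Complex.ofReal_sin,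
    Complex.ofReal_cos, Complex.ofReal_div, Complex.ofReal_ofNat]
  rw [hang, Complex.sin_sub_pi_div_two, Complex.cos_sub_pi_div_two, lommelNumerator]
  have hA := left_ne_zero_of_mul h
  have hB := right_ne_zero_of_mul h
  push_cast
  generalize gammaSeries _ _ _ = G
  field_simp
  ring

theorem lommel_exceptional_iff (μ ν : ℝ) :
    (∃ n : ℕ, μ + ν = -(2 * (n : ℝ) + 1) ∨ μ - ν = -(2 * (n : ℝ) + 1)) ↔
      rGamma (lommelParam μ ν + ν) * rGamma (lommelParam μ ν) = 0 := by
  rw [mul_eq_zero, rGamma_eq_zero_iff, rGamma_eq_zero_iff, ← exists_or]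
  refine exists_congr fun n => or_congr ?_ ?_
  · have : lommelParam μ ν + ν = (((μ + ν + 1) / 2 : ℝ) : ℂ) := by
      rw [lommelParam]; push_cast; ring
    rw [this, show -(n : ℂ) = ((-n : ℝ) : ℂ) by push_cast; rfl, Complex.ofReal_inj]
    constructor <;> intro h <;> linarith
  · have : lommelParam μ ν = (((μ - ν + 1) / 2 : ℝ) : ℂ) := by
      rw [lommelParam]; push_cast; ring
    rw [this, show -(n : ℂ) = ((-n : ℝ) : ℂ) by push_cast; rfl, Complex.ofReal_inj]
    constructor <;> intro h <;> linarith

theorem tendsto_lommelParam (μ ν : ℝ) :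
    Tendsto (fun w => lommelParam w ν) (𝓝[≠] μ) (𝓝[≠] (lommelParam μ ν)) := by
  refine tendsto_nhdsWithin_of_tendsto_nhds_of_eventually_within _ ?_ ?_
  · have : Continuous fun w => lommelParam w ν := by unfold lommelParam; fun_prop
    exact this.continuousAt.tendsto.mono_left nhdsWithin_le_nhds
  · filter_upwards [self_mem_nhdsWithin] with w hw h
    refine hw ?_
    have h' : ((w : ℂ) - ν + 1) / 2 = ((μ : ℂ) - ν + 1) / 2 := h
    have : (w : ℂ) = μ := by linear_combination 2 * h'
    exact_mod_cast this

theorem eventually_lommelS_eq (μ ν z : ℝ) :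
    ∀ᶠ w in 𝓝[≠] μ, rGamma (lommelParam w ν + ν) * rGamma (lommelParam w ν) ≠ 0 ∧
      lommelS w ν z = lommelSGeneric w ν z := by
  filter_upwards [(tendsto_lommelParam μ ν).eventually (eventually_rGamma_ne_zero ν _)] with w hw
  refine ⟨hw, ?_⟩
  rw [lommelS, if_neg]
  rwa [lommel_exceptional_iff]

/-- The Lommel function `S_{μ,ν}(z)` is continuous in `μ`, including the exceptional values. -/
theorem continuousAt_lommelS {z : ℝ} (hz : 0 < z) (μ ν : ℝ) :
    ContinuousAt (fun w => lommelS w ν z) μ := by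
  obtain ⟨L, hL⟩ := exists_tendsto_lommelNumerator_div hz ν (lommelParam μ ν)
  have hpow : Continuous fun w : ℝ => (((2 : ℝ) ^ (w - 1) : ℝ) : ℂ) := by
    have : Continuous fun w : ℝ => (2 : ℝ) ^ (w - 1) :=
      (Real.continuous_const_rpow two_ne_zero).comp (by fun_prop)
    fun_prop
  have h₁ := (hpow.continuousAt.tendsto.mono_left nhdsWithin_le_nhds).mul
    (hL.comp (tendsto_lommelParam μ ν))
  have h₂ : Tendsto (fun w => (lommelSGeneric w ν z : ℂ)) (𝓝[≠] μ)
      (𝓝 (((2 ^ (μ - 1) : ℝ) : ℂ) * L)) := by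
    refine h₁.congr' ?_
    filter_upwards [eventually_lommelS_eq μ ν z] with w hw
    exact (lommelSGeneric_eq hz w ν hw.1).symm
  have h₃ := tendsto_of_tendsto_ofReal h₂
  -- At exceptional $\mu$ the value is by definition the limit; elsewhere the denominator is nonzero
  -- and the quotient is continuous.
  have h₄ : lommelS μ ν z = (((2 ^ (μ - 1) : ℝ) : ℂ) * L).re := by
    by_cases h : ∃ n : ℕ, μ + ν = -(2 * (n : ℝ) + 1) ∨ μ - ν = -(2 * (n : ℝ) + 1)
    · rw [lommelS, if_pos h]
      exact h₃.limUnder_eq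
    · rw [lommelS, if_neg h]
      rw [lommel_exceptional_iff] at h
      have hc : ContinuousAt
          (fun c => lommelNumerator ν z c / (rGamma (c + ν) * rGamma c)) (lommelParam μ ν) :=
        (differentiable_lommelNumerator hz ν).continuous.continuousAt.div
          (((differentiable_rGamma_add ν).continuous.mul
            differentiable_rGamma.continuous).continuousAt) h
      rw [← tendsto_nhds_unique (hc.tendsto.mono_left nhdsWithin_le_nhds) hL,
        ← lommelSGeneric_eq hz μ ν h, Complex.ofReal_re]
  rw [continuousAt_iff_punctured_nhds, h₄]
  refine h₃.congr' ?_
  filter_upwards [eventually_lommelS_eq μ ν z] with w hw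
  exact hw.2.symm

/-! ### Formal power series and the Euler equation of the cross product. -/

/-- `∑ Xⁿ / (Γ(b+n+1) Γ(c+n+1))` as a formal power series. -/
noncomputable def gammaPowerSeries (b c : ℂ) : PowerSeries ℂ :=
  PowerSeries.mk fun n => rGamma (b + n + 1) * rGamma (c + n + 1)

/-- The Euler operator `X d/dX` on formal power series. -/
noncomputable def eulerOp (f : PowerSeries ℂ) : PowerSeries ℂ :=
  PowerSeries.X * PowerSeries.derivative ℂ f

theorem coeff_eulerOp (f : PowerSeries ℂ) (n : ℕ) :
    PowerSeries.coeff n (eulerOp f) = n * PowerSeries.coeff n f := by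
  cases n with
  | zero => simp [eulerOp]
  | succ n =>
    rw [eulerOp, PowerSeries.coeff_succ_X_mul, PowerSeries.coeff_derivative]
    push_cast
    ring

theorem eulerOp_mul (f g : PowerSeries ℂ) :
    eulerOp (f * g) = eulerOp f * g + f * eulerOp g := by
  simp only [eulerOp, Derivation.leibniz, smul_eq_mul]
  ring

theorem eulerOp_sub (f g : PowerSeries ℂ) : eulerOp (f - g) = eulerOp f - eulerOp g := by
  simp only [eulerOp, map_sub, mul_sub]

theorem gammaPowerSeries_comm (b c : ℂ) : gammaPowerSeries b c = gammaPowerSeries c b := by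
  simp [gammaPowerSeries, mul_comm (rGamma (b + _ + 1))]

/-- Coefficientwise this is $(b+n)/\Gamma(b+n+1)=1/\Gamma(b+n)$, the lowering relation in $b$. -/
theorem eulerOp_gammaPowerSeries (b c : ℂ) :
    eulerOp (gammaPowerSeries b c) =
      gammaPowerSeries (b - 1) c - PowerSeries.C b * gammaPowerSeries b c := by
  ext n
  rw [coeff_eulerOp, map_sub, PowerSeries.coeff_C_mul]
  simp only [gammaPowerSeries, PowerSeries.coeff_mk]
  rw [show b - 1 + (n : ℂ) + 1 = b + n by ring, rGamma_eq_mul (b + n)]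
  ring

theorem gammaPowerSeries_shift (b c : ℂ) :
    gammaPowerSeries (b - 1) (c - 1) =
      PowerSeries.C (rGamma b * rGamma c) + PowerSeries.X * gammaPowerSeries b c := by
  ext n
  cases n with
  | zero => simp [gammaPowerSeries]
  | succ n =>
    rw [map_add, PowerSeries.coeff_succ_X_mul, PowerSeries.coeff_C, if_neg n.succ_ne_zero]
    simp only [gammaPowerSeries, PowerSeries.coeff_mk]
    push_cast
    ring_nf

/-- The power series of `J_ν s_{μ-1,ν-1} - J_{ν-1} s_{μ,ν}`, up to normalization. -/
noncomputable def crossPowerSeries (b c : ℂ) : PowerSeries ℂ :=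
  gammaPowerSeries (b - c) 0 * gammaPowerSeries (b - 1) c -
    gammaPowerSeries (b - c - 1) 0 * gammaPowerSeries b c

/-- With $W$ the cross series and $\theta=X\,d/dX$, the lowering relations make all products cancel
in $\theta W+bW$ except the constant term of one shift times a Bessel series. This is the algebraic
form of integrating $t^\mu J_\nu(t)$. -/
theorem coeff_crossPowerSeries (b c : ℂ) (n : ℕ) :
    (n + b) * PowerSeries.coeff n (crossPowerSeries b c) =
      rGamma b * rGamma c * (rGamma (b - c + n + 1) * rGamma (n + 1)) := by
  have h₁ := eulerOp_gammaPowerSeries (b - c) 0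
  have h₂ := eulerOp_gammaPowerSeries c (b - 1)
  have h₃ := eulerOp_gammaPowerSeries 0 (b - c - 1)
  have h₄ := eulerOp_gammaPowerSeries b c
  have h₅ := gammaPowerSeries_shift b c
  have h₆ := gammaPowerSeries_shift (b - c) 0
  rw [gammaPowerSeries_comm (c - 1), gammaPowerSeries_comm c, h₅] at h₂
  rw [gammaPowerSeries_comm (0 - 1), gammaPowerSeries_comm 0, h₆, rGamma_zero, mul_zero, map_zero,
    zero_mul, zero_add, sub_zero] at h₃
  rw [map_sub] at h₁
  have key : eulerOp (crossPowerSeries b c) + PowerSeries.C b * crossPowerSeries b c =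
      PowerSeries.C (rGamma b * rGamma c) * gammaPowerSeries (b - c) 0 := by
    rw [crossPowerSeries, eulerOp_sub, eulerOp_mul, eulerOp_mul, h₁, h₂, h₃, h₄]
    ring
  have := congrArg (PowerSeries.coeff n) key
  rw [map_add, coeff_eulerOp, PowerSeries.coeff_C_mul, PowerSeries.coeff_C_mul] at this
  simp only [gammaPowerSeries, PowerSeries.coeff_mk, zero_add] at this
  rw [← this]
  ring

theorem hasSum_powerSeries_mul {f g : PowerSeries ℂ} {x F G : ℂ}
    (hf : Summable fun n => ‖x ^ n * PowerSeries.coeff n f‖)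
    (hg : Summable fun n => ‖x ^ n * PowerSeries.coeff n g‖)
    (hF : HasSum (fun n => x ^ n * PowerSeries.coeff n f) F)
    (hG : HasSum (fun n => x ^ n * PowerSeries.coeff n g) G) :
    HasSum (fun n => x ^ n * PowerSeries.coeff n (f * g)) (F * G) := by
  have e (n : ℕ) : x ^ n * PowerSeries.coeff n (f * g) =
      ∑ p ∈ Finset.HasAntidiagonal.antidiagonal n,
      (x ^ p.1 * PowerSeries.coeff p.1 f) * (x ^ p.2 * PowerSeries.coeff p.2 g) := by
    rw [PowerSeries.coeff_mul, Finset.mul_sum]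
    refine Finset.sum_congr rfl fun p hp => ?_
    rw [← Finset.HasAntidiagonal.mem_antidiagonal.1 hp, pow_add]
    ring
  simp only [e]
  rw [← hF.tsum_eq, ← hG.tsum_eq, tsum_mul_tsum_eq_tsum_sum_antidiagonal_of_summable_norm hf hg]
  exact (summable_norm_sum_mul_antidiagonal_of_summable_norm hf hg).of_norm.hasSum

theorem hasSum_crossPowerSeries (x b c : ℂ) :
    HasSum (fun n => x ^ n * PowerSeries.coeff n (crossPowerSeries b c))
      (gammaSeries x (b - c) 0 * gammaSeries x (b - 1) c -
        gammaSeries x (b - c - 1) 0 * gammaSeries x b c) := by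
  have h (b c : ℂ) : HasSum (fun n => x ^ n * PowerSeries.coeff n (gammaPowerSeries b c))
      (gammaSeries x b c) := by
    simpa only [gammaPowerSeries, PowerSeries.coeff_mk] using hasSum_gammaSeries x b c
  have h' (b c : ℂ) : Summable fun n => ‖x ^ n * PowerSeries.coeff n (gammaPowerSeries b c)‖ := by
    simpa only [gammaPowerSeries, PowerSeries.coeff_mk] using summable_norm_gammaSeries x b c
  have := (hasSum_powerSeries_mul (h' (b - c) 0) (h' (b - 1) c) (h _ _) (h _ _)).sub
    (hasSum_powerSeries_mul (h' (b - c - 1) 0) (h' b c) (h _ _) (h _ _))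
  simpa only [crossPowerSeries, map_sub, mul_sub] using this

/-! ### Wronskians of Bessel functions. -/

/-- The Wronskian of `J_ν` and `J_{-ν}` in terms of the series. -/
theorem gammaSeries_wronskian (x ν : ℂ) :
    gammaSeries x (-ν) 0 * gammaSeries x (ν - 1) 0 -
      x * (gammaSeries x ν 0 * gammaSeries x (1 - ν) 0) = rGamma ν * rGamma (1 - ν) := by
  -- With $b=0$ the right side of the Euler equation carries $1/\Gamma(0)=0$, so every coefficient
  -- with $n\ne0$ vanishes and the cross product is constant in $x$.
  have h := hasSum_crossPowerSeries x 0 (-ν)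
  have h0 (n : ℕ) (hn : n ≠ 0) :
      x ^ n * PowerSeries.coeff n (crossPowerSeries 0 (-ν)) = 0 := by
    have := coeff_crossPowerSeries 0 (-ν) n
    rw [rGamma_zero, zero_mul, zero_mul, add_zero] at this
    rw [(mul_eq_zero.1 this).resolve_left (by exact_mod_cast hn), mul_zero]
  have h1 := h.unique (hasSum_single 0 h0)
  have h2 : PowerSeries.coeff 0 (crossPowerSeries 0 (-ν)) = -(rGamma ν * rGamma (1 - ν)) := by
    have : rGamma 1 = 1 := by simpa using rGamma_nat_add_one 0
    simp [crossPowerSeries, gammaPowerSeries, rGamma_zero, this]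
    exact Or.inl (by ring_nf)
  have h3 := gammaSeries_shift x (0 - 1) (-ν)
  rw [sub_add_cancel, rGamma_zero, zero_mul, zero_add] at h3
  rw [h2, pow_zero, one_mul, h3, show -ν + 1 = 1 - ν by ring, gammaSeries_comm x 0 (1 - ν),
    gammaSeries_comm x 0 (-ν), show (0 : ℂ) - -ν = ν by ring] at h1
  linear_combination -h1

theorem besselJ_wronskian {z : ℝ} (hz : 0 < z) (ν : ℝ) :
    besselJ (ν - 1) z * besselJ (-ν) z + besselJ ν z * besselJ (1 - ν) z =
      2 * Real.sin (ν * Real.pi) / (Real.pi * z) := by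
  have h0 : ((z / 2 : ℝ) : ℂ) ≠ 0 := by exact_mod_cast (by positivity : z / 2 ≠ 0)
  have hw := gammaSeries_wronskian (-((z / 2 : ℝ) : ℂ) ^ 2) ν
  rw [rGamma_mul_one_sub] at hw
  have hpi : (Real.pi : ℂ) ≠ 0 := by exact_mod_cast Real.pi_ne_zero
  have hz' : (z : ℂ) ≠ 0 := by exact_mod_cast hz.ne'
  have key : (besselJ (ν - 1) z * besselJ (-ν) z + besselJ ν z * besselJ (1 - ν) z : ℂ) =
      2 * Complex.sin (ν * Real.pi) / (Real.pi * z) := by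
    simp only [besselJ_ofReal hz, cBesselJ]
    push_cast at h0 hw ⊢
    rw [Complex.cpow_sub _ _ h0, Complex.cpow_sub _ _ h0, Complex.cpow_neg, Complex.cpow_one]
    rw [mul_comm (Real.pi : ℂ)] at hw
    have hne : ((z : ℂ) / 2) ^ (ν : ℂ) ≠ 0 := by simp [Complex.cpow_eq_zero_iff, h0]
    generalize ((z : ℂ) / 2) ^ (ν : ℂ) = A at *
    generalize gammaSeries _ _ _ = G₁ at *
    generalize gammaSeries _ _ _ = G₂ at *
    generalize gammaSeries _ _ _ = G₃ at *
    generalize gammaSeries _ _ _ = G₄ at *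
    generalize Complex.sin _ = s at *
    field_simp at hw ⊢
    linear_combination hw
  exact_mod_cast key

theorem besselYGeneric_wronskian {z : ℝ} (hz : 0 < z) {ν : ℝ} (hν : Real.sin (ν * Real.pi) ≠ 0) :
    besselJ (ν - 1) z * besselYGeneric ν z - besselJ ν z * besselYGeneric (ν - 1) z =
      -(2 / (Real.pi * z)) := by
  have h := besselJ_wronskian hz ν
  have hs : Real.sin ((ν - 1) * Real.pi) = -Real.sin (ν * Real.pi) := by
    rw [sub_mul, one_mul, Real.sin_sub_pi]
  have hc : Real.cos ((ν - 1) * Real.pi) = -Real.cos (ν * Real.pi) := by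
    rw [sub_mul, one_mul, Real.cos_sub_pi]
  rw [besselYGeneric, besselYGeneric, hs, hc, neg_sub]
  have hpi := Real.pi_ne_zero
  field_simp at h ⊢
  linear_combination -h

theorem continuous_besselJ_order {z : ℝ} (hz : 0 < z) : Continuous fun ν => besselJ ν z := by
  have h1 : Continuous (cBesselJ (z / 2)) := by
    have : Differentiable ℂ (cBesselJ (z / 2)) :=
      fun ν => (hasDerivAt_cBesselJ (show 0 < z / 2 by positivity) ν).differentiableAt
    exact this.continuous
  have h2 : (fun ν => besselJ ν z) = fun ν : ℝ => (cBesselJ (z / 2) ν).re := by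
    ext ν
    rw [← besselJ_ofReal hz, Complex.ofReal_re]
  rw [h2]
  exact Complex.continuous_re.comp (h1.comp Complex.continuous_ofReal)

theorem sin_mul_pi_ne_zero {ν : ℝ} (hν : ¬∃ n : ℤ, ν = n) : Real.sin (ν * Real.pi) ≠ 0 := by
  rw [Real.sin_ne_zero_iff]
  intro n hn
  exact hν ⟨n, (mul_right_cancel₀ Real.pi_ne_zero hn).symm⟩

theorem tendsto_besselYGeneric_sub_one {z : ℝ} (hz : 0 < z) (p q : ℕ) :
    Tendsto (fun w => besselYGeneric (w - 1) z) (𝓝[≠] ((p : ℝ) - q))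
      (𝓝 (besselY (p - q - 1) z)) := by
  have h := (tendsto_besselYGeneric_int hz p (q + 1)).1
  rw [show (p : ℝ) - (q + 1 : ℕ) = p - q - 1 by push_cast; ring] at h
  refine h.comp (tendsto_nhdsWithin_of_tendsto_nhds_of_eventually_within _ ?_ ?_)
  · exact (continuous_id.sub continuous_const).continuousAt.tendsto.mono_left nhdsWithin_le_nhds
  · filter_upwards [self_mem_nhdsWithin] with w hw h
    refine hw ?_
    have : w - 1 = (p : ℝ) - q - 1 := h
    simpa using this

/-- For nonintegral order this is the $J_\nu,J_{-\nu}$ Wronskian with $\sin(\nu\pi)$ divided out;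
integral order follows by passing to the limit in $\nu$. It evaluates the $Y$ part of the Lommel
combination. -/
theorem besselY_wronskian {z : ℝ} (hz : 0 < z) (ν : ℝ) :
    besselJ (ν - 1) z * besselY ν z - besselJ ν z * besselY (ν - 1) z =
      -(2 / (Real.pi * z)) := by
  by_cases hν : ∃ n : ℤ, ν = n
  · obtain ⟨n, rfl⟩ := hν
    obtain ⟨p, q, rfl⟩ : ∃ p q : ℕ, n = p - q := ⟨n.toNat, (-n).toNat, by omega⟩
    push_cast
    have hJ := continuous_besselJ_order hz
    have hJ' : Continuous fun ν => besselJ (ν - 1) z := hJ.comp (by fun_prop)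
    have h := ((hJ'.tendsto ((p : ℝ) - q)).mono_left nhdsWithin_le_nhds).mul
      (tendsto_besselYGeneric_int hz p q).1 |>.sub
      (((hJ.tendsto ((p : ℝ) - q)).mono_left nhdsWithin_le_nhds).mul
        (tendsto_besselYGeneric_sub_one hz p q))
    refine tendsto_nhds_unique h (tendsto_const_nhds.congr' ?_)
    have hlin : HasDerivAt (fun w : ℝ => w * Real.pi) Real.pi ((p : ℝ) - q) := by
      simpa using (hasDerivAt_id ((p : ℝ) - q)).mul_const Real.pi
    have hne := hlin.sin.eventually_ne (c := 0) (mul_ne_zero (by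
      rw [sub_mul, Real.cos_sub, Real.sin_nat_mul_pi, Real.cos_nat_mul_pi, Real.cos_nat_mul_pi]
      simp) Real.pi_ne_zero)
    filter_upwards [hne] with w hw
    exact (besselYGeneric_wronskian hz hw).symm
  · have hν' : ¬∃ n : ℤ, ν - 1 = n := by
      rintro ⟨n, hn⟩
      exact hν ⟨n + 1, by push_cast; linarith⟩
    rw [besselY_of_not_int hν, besselY_of_not_int hν',
      besselYGeneric_wronskian hz (sin_mul_pi_ne_zero hν)]

/-! ### The Bessel–Lommel combination as a series. -/

/-- The combination of Bessel and Lommel functions that integrates `t^μ J_ν(t)`, at nonexceptional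
parameters. -/
theorem besselJ_mul_lommelSGeneric_sub {z : ℝ} (hz : 0 < z) (μ ν : ℝ)
    (h₁ : rGamma (lommelParam μ ν + ν) * rGamma (lommelParam μ ν) ≠ 0)
    (h₂ : rGamma (lommelParam (μ - 1) (ν - 1) + (ν - 1 : ℝ)) *
      rGamma (lommelParam (μ - 1) (ν - 1)) ≠ 0) :
    ((((μ + ν - 1) * besselJ ν z * lommelSGeneric (μ - 1) (ν - 1) z -
      besselJ (ν - 1) z * lommelSGeneric μ ν z : ℝ)) : ℂ) =
    ((2 ^ (μ - 1) : ℝ) : ℂ) * (((z / 2 : ℝ) : ℂ) ^ (μ + ν : ℂ) *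
      (∑' n : ℕ, (-((z / 2 : ℝ) : ℂ) ^ 2) ^ n * (rGamma (ν + n + 1) * rGamma (n + 1)) /
        (n + (μ + ν + 1) / 2)) -
      2 / z * (rGamma (1 - lommelParam μ ν) / rGamma (lommelParam μ ν + ν))) := by
  have hc : lommelParam (μ - 1) (ν - 1) = lommelParam μ ν := by
    unfold lommelParam; push_cast; ring
  have hW := besselY_wronskian hz ν
  have hS₁ := lommelSGeneric_eq hz μ ν h₁
  have hS₂ := lommelSGeneric_eq hz (μ - 1) (ν - 1) h₂
  rw [hc] at hS₂ h₂
  set c := lommelParam μ ν with hcdef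
  set x : ℂ := -((z / 2 : ℝ) : ℂ) ^ 2
  set b := c + ν with hb
  have hb' : c + ((ν - 1 : ℝ) : ℂ) = b - 1 := by rw [hb]; push_cast; ring
  have hν : (ν : ℂ) = b - c := by rw [hb]; ring
  have hbμ : b = (μ + ν + 1) / 2 := by rw [hb, hcdef, lommelParam]; ring
  -- Both Lommel functions share the same $c$. The coefficient $\mu+\nu-1=2(b-1)$ cancels this
  -- factor $b-1$, which gives them a common denominator.
  have hR : rGamma (b - 1) = (b - 1) * rGamma b := by
    rw [rGamma_eq_mul (b - 1), sub_add_cancel]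
  rw [hb', hR] at hS₂ h₂
  have hb1 := left_ne_zero_of_mul (left_ne_zero_of_mul h₂)
  have hRb := left_ne_zero_of_mul h₁
  have hRc := right_ne_zero_of_mul h₁
  have hbn (n : ℕ) : (n : ℂ) + b ≠ 0 := by
    intro h
    refine hRb ((rGamma_eq_zero_iff b).2 ⟨n, by linear_combination h⟩)
  have hcross : gammaSeries x ν 0 * gammaSeries x (b - 1) c -
      gammaSeries x (ν - 1) 0 * gammaSeries x b c = rGamma b * rGamma c *
        ∑' n : ℕ, x ^ n * (rGamma (ν + n + 1) * rGamma (n + 1)) / (n + b) := by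
    rw [hν, ← (hasSum_crossPowerSeries x b c).tsum_eq, ← tsum_mul_left]
    congr 1
    ext n
    have := hbn n
    field_simp
    linear_combination x ^ n * coeff_crossPowerSeries b c n
  have hpow : ((2 ^ (μ - 1 - 1) : ℝ) : ℂ) = ((2 ^ (μ - 1) : ℝ) : ℂ) / 2 := by
    rw [Real.rpow_sub_one two_ne_zero (μ - 1)]; push_cast; rfl
  have hWc := congrArg (fun t : ℝ => (t : ℂ)) hW
  have hrefl := rGamma_mul_one_sub c
  have hpi : (Real.pi : ℂ) ≠ 0 := by exact_mod_cast Real.pi_ne_zero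
  have hz' : (z : ℂ) ≠ 0 := by exact_mod_cast hz.ne'
  have h0 : ((z / 2 : ℝ) : ℂ) ≠ 0 := by exact_mod_cast (by positivity : z / 2 ≠ 0)
  have hJ₁ := besselJ_ofReal hz ν
  have hJ₂ := besselJ_ofReal hz (ν - 1)
  have hcoef : ((μ : ℂ) + ν - 1) = 2 * (b - 1) := by rw [hbμ]; ring
  rw [cBesselJ] at hJ₁ hJ₂
  push_cast at hWc hJ₂ hJ₁
  push_cast at hS₁ hS₂ hpow ⊢
  rw [← hbμ, hS₁, hS₂, hcoef, hpow, lommelNumerator, lommelNumerator, hb', ← hb,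
    show (μ : ℂ) + ν = b + c - 1 + ν by rw [hbμ, hcdef, lommelParam]; ring,
    show b - 1 + c = b + c - 1 by ring]
  simp only [Complex.ofReal_div, Complex.ofReal_ofNat] at h0 ⊢
  rw [Complex.cpow_sub _ _ h0, Complex.cpow_one] at hJ₂
  have hE : ((z : ℂ) / 2) ^ (b + c) = (z / 2) ^ (b + c - 1) * (z / 2) := by
    rw [Complex.cpow_sub _ _ h0, Complex.cpow_one, div_mul_cancel₀ _ h0]
  rw [hE, Complex.cpow_add _ _ h0]
  have hx : -((z : ℂ) / 2) ^ 2 = x := by simp [x]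
  rw [hx] at hJ₁ hJ₂ ⊢
  rw [mul_comm (Real.pi : ℂ)] at hrefl
  generalize hT : ∑' n : ℕ, x ^ n * (rGamma (ν + n + 1) * rGamma (n + 1)) / (n + b) = T at *
  generalize ((z : ℂ) / 2) ^ (b + c - 1) = E at *
  generalize ((z : ℂ) / 2) ^ (ν : ℂ) = A at *
  generalize Complex.sin (c * Real.pi) = s at *
  generalize Complex.cos (c * Real.pi) = co at *
  -- The cosine terms cancel, the series terms form the cross product, and the $Y$ terms form the
  -- Wronskian times $\sin(c\pi)=\pi/(\Gamma(c)\Gamma(1-c))$.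
  have main : (besselJ ν z : ℂ) * (E * gammaSeries x (b - 1) c - co * besselJ (ν - 1) z -
      s * besselY (ν - 1) z) - besselJ (ν - 1) z * (E * (z / 2) * gammaSeries x b c -
      co * besselJ ν z - s * besselY ν z) =
      rGamma b * rGamma c * (E * A * T) - 2 / z * (rGamma c * rGamma (1 - c)) := by
    have e : (besselJ (ν - 1) z : ℂ) * (z / 2) = A * gammaSeries x (ν - 1) 0 := by
      rw [hJ₂]; field_simp
    rw [hrefl]
    linear_combination E * A * hcross + s * hWc + E * gammaSeries x (b - 1) c * hJ₁ -
      E * gammaSeries x b c * e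
  generalize ((2 : ℝ) ^ (μ - 1) : ℝ) = P at *
  field_simp at main ⊢
  linear_combination P * main

/-! ### The spectral series and its analyticity in α. -/

/-- The scaled eigenvalue as a series in `-(a/2)²`, with `a = kδ`. -/
noncomputable def spectralSeries (d : ℕ) (a α : ℝ) : ℝ :=
  ∑' n : ℕ, (-(a / 2) ^ 2) ^ (n + 1) /
    (((n + 1).factorial : ℝ) * Real.Gamma ((d : ℝ) / 2 + (n + 1 : ℕ)) *
      (((d : ℝ) - α) / 2 + (n + 1 : ℕ)))

/-- The summands of `spectralSeries` with the parameter complexified, including the one of index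
zero. -/
noncomputable def spectralTerm (d : ℕ) (a : ℝ) (b : ℂ) (n : ℕ) : ℂ :=
  (-((a / 2 : ℝ) : ℂ) ^ 2) ^ n *
    (rGamma ((((d : ℝ) - 2) / 2 : ℝ) + n + 1) * rGamma (n + 1)) / (n + b)

theorem spectralTerm_ofReal (d : ℕ) (a α : ℝ) (n : ℕ) :
    spectralTerm d a (((d : ℝ) - α) / 2 : ℝ) n = (((-(a / 2) ^ 2) ^ n /
      ((n.factorial : ℝ) * Real.Gamma ((d : ℝ) / 2 + n) * (((d : ℝ) - α) / 2 + n)) : ℝ) : ℂ) := by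
  have h : ((((d : ℝ) - 2) / 2 : ℝ) : ℂ) + n + 1 = (((d : ℝ) / 2 + n : ℝ) : ℂ) := by
    push_cast; ring
  rw [spectralTerm, h, rGamma_ofReal, rGamma_nat_add_one]
  have hx : -((a / 2 : ℝ) : ℂ) ^ 2 = ((-(a / 2) ^ 2 : ℝ) : ℂ) := by push_cast; rfl
  rw [hx]
  generalize -(a / 2) ^ 2 = x
  generalize Real.Gamma ((d : ℝ) / 2 + n) = G
  generalize ((d : ℝ) - α) / 2 = b
  push_cast
  rw [div_eq_mul_inv, div_eq_mul_inv, mul_inv, mul_inv, add_comm (n : ℂ)]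
  ring

theorem summable_norm_spectralTerm (d : ℕ) (a : ℝ) :
    Summable fun n : ℕ => ‖(-((a / 2 : ℝ) : ℂ) ^ 2) ^ n *
      (rGamma ((((d : ℝ) - 2) / 2 : ℝ) + n + 1) * rGamma (n + 1))‖ := by
  have := summable_norm_gammaSeries (-((a / 2 : ℝ) : ℂ) ^ 2) ((((d : ℝ) - 2) / 2 : ℝ)) 0
  simp only [zero_add] at this
  exact this

theorem summable_spectralTerm (d : ℕ) (a : ℝ) (b : ℂ) : Summable (spectralTerm d a b) := by
  refine Summable.of_norm_bounded_eventually_nat (summable_norm_spectralTerm d a) ?_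
  obtain ⟨N, hN⟩ := exists_nat_ge (1 + ‖b‖)
  filter_upwards [eventually_ge_atTop N] with n hn
  have h1 : 1 ≤ ‖(n : ℂ) + b‖ := by
    have h2 : ‖(n : ℂ)‖ ≤ ‖(n : ℂ) + b‖ + ‖b‖ := by
      calc ‖(n : ℂ)‖ = ‖((n : ℂ) + b) - b‖ := by ring_nf
        _ ≤ _ := norm_sub_le _ _
    rw [Complex.norm_natCast] at h2
    have : (N : ℝ) ≤ n := by exact_mod_cast hn
    linarith
  rw [spectralTerm, norm_div]
  exact div_le_self (norm_nonneg _) h1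

/-- Without the summand $n=0$ the first pole is at $b=-1$. On $\operatorname{Re}b>-1+r$ all
denominators are at least $r$ in modulus, so a single majorant works. -/
theorem differentiableOn_spectralSeries (d : ℕ) (a : ℝ) :
    DifferentiableOn ℂ (fun b => ∑' n : ℕ, spectralTerm d a b (n + 1)) {b | -1 < b.re} := by
  have hopen (r : ℝ) : IsOpen {b : ℂ | -1 + r < b.re} :=
    isOpen_lt continuous_const Complex.continuous_re
  have key (r : ℝ) (hr : 0 < r) :
      DifferentiableOn ℂ (fun b => ∑' n : ℕ, spectralTerm d a b (n + 1)) {b | -1 + r < b.re} := by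
    have hre (n : ℕ) (b : ℂ) (hb : -1 + r < b.re) : r ≤ ‖((n + 1 : ℕ) : ℂ) + b‖ := by
      refine le_trans ?_ (Complex.re_le_norm _)
      have : (0 : ℝ) ≤ n := n.cast_nonneg
      simp only [Complex.add_re, Complex.natCast_re]
      push_cast
      linarith
    refine Complex.differentiableOn_tsum_of_summable_norm
      (((summable_nat_add_iff 1).2 (summable_norm_spectralTerm d a)).div_const r) ?_ (hopen r) ?_
    · intro n b hb
      have : ((n + 1 : ℕ) : ℂ) + b ≠ 0 := norm_pos_iff.1 (hr.trans_le (hre n b hb))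
      unfold spectralTerm
      exact (DifferentiableAt.div (by fun_prop) (by fun_prop) this).differentiableWithinAt
    · intro n b hb
      rw [spectralTerm, norm_div]
      gcongr
      exact hre n b hb
  intro b hb
  have hb' : -1 < b.re := hb
  refine ((key ((b.re + 1) / 2) (by linarith)).differentiableAt
    ((hopen _).mem_nhds ?_)).differentiableWithinAt
  change -1 + (b.re + 1) / 2 < b.re
  linarith

theorem spectralSeries_ofReal (d : ℕ) (a α : ℝ) :
    (spectralSeries d a α : ℂ) =
      ∑' n : ℕ, spectralTerm d a (((d : ℝ) - α) / 2 : ℝ) (n + 1) := by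
  simp only [spectralTerm_ofReal]
  rw [spectralSeries, Complex.ofReal_tsum]

theorem analyticAt_spectralSeries (d : ℕ) (a : ℝ) {α : ℝ} (hα : α < d + 2) :
    AnalyticAt ℝ (spectralSeries d a) α := by
  have hopen : IsOpen {b : ℂ | -1 < b.re} := isOpen_lt continuous_const Complex.continuous_re
  have h1 : AnalyticAt ℂ (fun b => ∑' n : ℕ, spectralTerm d a b (n + 1))
      ((((d : ℝ) - α) / 2 : ℝ) : ℂ) :=
    (differentiableOn_spectralSeries d a).analyticAt (hopen.mem_nhds (by
      change -1 < ((((d : ℝ) - α) / 2 : ℝ) : ℂ).re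
      rw [Complex.ofReal_re]; linarith))
  have h2 : AnalyticAt ℝ (fun α : ℝ => ((((d : ℝ) - α) / 2 : ℝ) : ℂ)) α :=
    AnalyticAt.fun_comp (g := Complex.ofRealCLM) (Complex.ofRealCLM.analyticAt _)
      ((analyticAt_const.sub analyticAt_id).div_const)
  have h3 := AnalyticAt.fun_comp (Complex.reCLM.analyticAt _)
    (AnalyticAt.fun_comp (f := fun α : ℝ => ((((d : ℝ) - α) / 2 : ℝ) : ℂ))
      (h1.restrictScalars (𝕜 := ℝ)) h2)
  refine h3.congr (Eventually.of_forall fun w => ?_)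
  beta_reduce
  rw [← spectralSeries_ofReal]
  simp

/-! ### The closed form: generic exponents, then all exponents by continuity. -/

/-- The closed form of the spectral series at parameters where the Lommel functions are given by
their generic formula. -/
theorem gammaPart_add_besselLommelPart_of_generic {d : ℕ} {a : ℝ} (ha : 0 < a)
    {α : ℝ} {μ ν : ℝ} (hμ : μ = ((d : ℝ) - 2 * α) / 2) (hν : ν = ((d : ℝ) - 2) / 2)
    (h₁ : rGamma (lommelParam μ ν + ν) * rGamma (lommelParam μ ν) ≠ 0 ∧
      lommelS μ ν a = lommelSGeneric μ ν a)
    (h₂ : rGamma (lommelParam (μ - 1) (ν - 1) + (ν - 1 : ℝ)) *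
      rGamma (lommelParam (μ - 1) (ν - 1)) ≠ 0 ∧
      lommelS (μ - 1) (ν - 1) a = lommelSGeneric (μ - 1) (ν - 1) a) :
    gammaPart d a α + besselLommelPart d a α = spectralSeries d a α := by
  have hmain := besselJ_mul_lommelSGeneric_sub ha μ ν h₁.1 h₂.1
  have hb : lommelParam μ ν + ν = (((d : ℝ) - α) / 2 : ℝ) := by
    rw [lommelParam, hμ, hν]; push_cast; ring
  have hc : 1 - lommelParam μ ν = (α / 2 : ℝ) := by
    rw [lommelParam, hμ, hν]; push_cast; ring
  have hb0 : ((d : ℝ) - α) / 2 ≠ 0 := by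
    intro h
    refine left_ne_zero_of_mul h₁.1 ?_
    rw [hb, h, Complex.ofReal_zero, rGamma_zero]
  have hdα : (d : ℝ) - α ≠ 0 := by
    intro h; exact hb0 (by rw [h, zero_div])
  -- The summand $n=0$ is the rational term subtracted in `gammaPart`; the rest is the spectral
  -- series.
  have hsum : ∑' n : ℕ, (-((a / 2 : ℝ) : ℂ) ^ 2) ^ n * (rGamma (ν + n + 1) * rGamma (n + 1)) /
      (n + ((μ : ℂ) + ν + 1) / 2) =
      ((2 / (((d : ℝ) - α) * Real.Gamma ((d : ℝ) / 2)) + spectralSeries d a α : ℝ) : ℂ) := by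
    have e : ((μ : ℂ) + ν + 1) / 2 = (((d : ℝ) - α) / 2 : ℝ) := by
      rw [hμ, hν]; push_cast; ring
    have hbn (n : ℕ) : (n : ℂ) + (((d : ℝ) - α) / 2 : ℝ) ≠ 0 := by
      intro h
      refine left_ne_zero_of_mul h₁.1 ?_
      rw [hb]
      exact (rGamma_eq_zero_iff _).2 ⟨n, by linear_combination h⟩
    rw [e, hν]
    change ∑' n : ℕ, spectralTerm d a (((d : ℝ) - α) / 2 : ℝ) n = _
    rw [(summable_spectralTerm d a _).tsum_eq_zero_add, ← spectralSeries_ofReal,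
      spectralTerm_ofReal, ← Complex.ofReal_add]
    congr 2
    simp
    field_simp
  rw [hb, hc, hsum, rGamma_ofReal, rGamma_ofReal] at hmain
  have hexp : ((a / 2 : ℝ) : ℂ) ^ (μ + ν : ℂ) = (((a / 2) ^ ((d : ℝ) - 1 - α) : ℝ) : ℂ) := by
    rw [Complex.ofReal_cpow (by positivity), hμ, hν]
    congr 1
    push_cast; ring
  rw [hexp] at hmain
  have hreal : (μ + ν - 1) * besselJ ν a * lommelSGeneric (μ - 1) (ν - 1) a -
      besselJ (ν - 1) a * lommelSGeneric μ ν a =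
      2 ^ (μ - 1) * ((a / 2) ^ ((d : ℝ) - 1 - α) *
        (2 / (((d : ℝ) - α) * Real.Gamma ((d : ℝ) / 2)) + spectralSeries d a α) -
        2 / a * ((Real.Gamma (α / 2))⁻¹ / (Real.Gamma (((d : ℝ) - α) / 2))⁻¹)) := by
    exact_mod_cast hmain
  have hpre : 2 ^ ((d : ℝ) / 2) * a ^ (α + 1 - d) * 2 ^ (μ - 1) = (a / 2) ^ (α + 1 - d) := by
    rw [Real.div_rpow ha.le two_pos.le, div_eq_mul_inv (a ^ (α + 1 - d)),
      ← Real.rpow_neg two_pos.le, mul_right_comm, ← Real.rpow_add two_pos, mul_comm]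
    congr 2
    rw [hμ]; ring
  have hB : besselLommelPart d a α = 2 / (((d : ℝ) - α) * Real.Gamma ((d : ℝ) / 2)) +
      spectralSeries d a α -
      (a / 2) ^ (α - d) * Real.Gamma (((d : ℝ) - α) / 2) / Real.Gamma (α / 2) := by
    have hp1 : (a / 2) ^ (α + 1 - d) * (a / 2) ^ ((d : ℝ) - 1 - α) = 1 := by
      rw [← Real.rpow_add (by positivity), show α + 1 - d + (d - 1 - α) = 0 by ring, Real.rpow_zero]
    have hp2 : (a / 2) ^ (α + 1 - d) * (2 / a) = (a / 2) ^ (α - d) := by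
      rw [show α + 1 - d = α - d + 1 by ring, Real.rpow_add_one (by positivity)]
      field_simp
    rw [besselLommelPart, show (d - 2 - 2 * α) / 2 = μ - 1 by rw [hμ]; ring, ← hμ, ← hν,
      show ((d : ℝ) - 4) / 2 = ν - 1 by rw [hν]; ring, show (d : ℝ) - 2 - α = μ + ν - 1 by
        rw [hμ, hν]; ring, h₁.2, h₂.2, hreal, ← mul_assoc, hpre]
    rw [inv_div_inv]
    linear_combination (2 / (((d : ℝ) - α) * Real.Gamma ((d : ℝ) / 2)) +
      spectralSeries d a α) * hp1 - Real.Gamma (((d : ℝ) - α) / 2) / Real.Gamma (α / 2) * hp2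
  rw [gammaPart, hB]
  ring

theorem continuous_inv_Gamma : Continuous fun s : ℝ => (Real.Gamma s)⁻¹ := by
  have : (fun s : ℝ => (Real.Gamma s)⁻¹) = fun s : ℝ => (rGamma s).re := by
    ext s
    rw [rGamma_ofReal, Complex.ofReal_re]
  rw [this]
  exact Complex.continuous_re.comp
    (differentiable_rGamma.continuous.comp Complex.continuous_ofReal)

/-- Since $\Gamma(\frac{d-\alpha}2)=\frac2{d-\alpha}\Gamma(\frac{d-\alpha}2+1)$, the expression is
$-2$ times the difference quotient at $d$ of
$(a/2)^{\alpha-d}\,\Gamma(\frac{d-\alpha}2+1)/\Gamma(\frac\alpha2)$, so its limit is a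
logarithmic-derivative computation. -/
theorem tendsto_gammaPart_dim {d : ℕ} (hd : 1 ≤ d) {a : ℝ} (ha : 0 < a) :
    Tendsto (gammaPart d a) (𝓝[≠] (d : ℝ)) (𝓝 (gammaPartAtDim d a)) := by
  have hd0 : (0 : ℝ) < d := by exact_mod_cast hd
  have hG {s : ℝ} (hs : 0 < s) : HasDerivAt Real.Gamma (deriv Real.Gamma s) s :=
    (Real.differentiableAt_Gamma fun m => by
      have : (0 : ℝ) ≤ m := m.cast_nonneg
      linarith).hasDerivAt
  have hG0 : Real.Gamma ((d : ℝ) / 2) ≠ 0 := (Real.Gamma_pos_of_pos (by positivity)).ne'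
  have h1 : HasDerivAt (fun α : ℝ => (a / 2) ^ (α - d)) (Real.log (a / 2)) d := by
    have := ((hasDerivAt_id (d : ℝ)).sub_const (d : ℝ)).const_rpow (a := a / 2) (by positivity)
    simpa using this
  have h2 : HasDerivAt (fun α : ℝ => Real.Gamma (((d : ℝ) - α) / 2 + 1))
      (deriv Real.Gamma 1 * (-1 / 2)) d := by
    have hl : HasDerivAt (fun α : ℝ => ((d : ℝ) - α) / 2 + 1) (-1 / 2) d :=
      (((hasDerivAt_id (d : ℝ)).const_sub (d : ℝ)).div_const 2).add_const 1
    have := hG one_pos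
    rw [show (1 : ℝ) = ((d : ℝ) - d) / 2 + 1 by simp] at this
    refine (this.comp (d : ℝ) hl).congr_deriv ?_
    simp
  have h3 : HasDerivAt (fun α : ℝ => Real.Gamma (α / 2))
      (deriv Real.Gamma ((d : ℝ) / 2) * (1 / 2)) d :=
    (hG (by positivity)).comp (d : ℝ) ((hasDerivAt_id (d : ℝ)).div_const 2)
  have h4 := ((h1.mul h2).div h3 hG0).tendsto_slope.const_mul (-2)
  refine (h4.congr' ?_).trans (le_of_eq ?_)
  · filter_upwards [self_mem_nhdsWithin] with α hα
    have hne : α - d ≠ 0 := sub_ne_zero.2 hα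
    have hne' : (d : ℝ) - α ≠ 0 := sub_ne_zero.2 (Ne.symm hα)
    rw [slope_def_field, gammaPart]
    simp only [Pi.div_apply, Pi.mul_apply, sub_self, Real.rpow_zero, zero_div, zero_add,
      Real.Gamma_one]
    rw [Real.Gamma_add_one (s := ((d : ℝ) - α) / 2) (div_ne_zero hne' two_ne_zero)]
    have : α - d = -((d : ℝ) - α) := by ring
    simp only [div_eq_mul_inv] at *
    generalize (Real.Gamma (α * 2⁻¹))⁻¹ = G at *
    generalize (a * 2⁻¹) ^ (α - d) = p at *
    rw [this]
    field_simp
  · rw [gammaPartAtDim]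
    congr 1
    have hlog : Real.log (2 / a) = -Real.log (a / 2) := by
      rw [← Real.log_inv, inv_div]
    rw [hlog]
    simp only [Pi.mul_apply, sub_self, Real.rpow_zero, zero_div, zero_add, Real.Gamma_one]
    field_simp
    ring

theorem continuousAt_gammaPart {d : ℕ} {a : ℝ} (ha : 0 < a) {α : ℝ} (hα : α < d + 2)
    (hαd : α ≠ d) : ContinuousAt (gammaPart d a) α := by
  have hne : (d : ℝ) - α ≠ 0 := sub_ne_zero.2 (Ne.symm hαd)
  have h1 : ContinuousAt (fun α : ℝ => (a / 2) ^ (α - d)) α :=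
    ((Real.continuous_const_rpow (by positivity)).comp (by fun_prop)).continuousAt
  have h2 : ContinuousAt (fun α : ℝ => Real.Gamma (((d : ℝ) - α) / 2)) α := by
    refine ContinuousAt.comp (g := Real.Gamma)
      (Real.differentiableAt_Gamma fun m h => ?_).continuousAt (by fun_prop)
    cases m with
    | zero => exact hne (by simpa using h)
    | succ m =>
      have : (0 : ℝ) ≤ m := m.cast_nonneg
      push_cast at h
      linarith
  have h3 : ContinuousAt (fun α : ℝ => (Real.Gamma (α / 2))⁻¹) α :=
    (continuous_inv_Gamma.comp (by fun_prop : Continuous fun α : ℝ => α / 2)).continuousAt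
  have h4 : ContinuousAt (fun α : ℝ => 2 / (((d : ℝ) - α) * Real.Gamma ((d : ℝ) / 2))) α := by
    have h5 : (fun α : ℝ => 2 / (((d : ℝ) - α) * Real.Gamma ((d : ℝ) / 2))) =
        fun α : ℝ => 2 / ((d : ℝ) - α) / Real.Gamma ((d : ℝ) / 2) := by
      ext; rw [div_div]
    rw [h5]
    exact (ContinuousAt.div (by fun_prop) (by fun_prop) hne).div_const _
  exact ((h1.mul h2).mul h3).sub h4

theorem continuousAt_update_gammaPart {d : ℕ} (hd : 1 ≤ d) {a : ℝ} (ha : 0 < a) {α : ℝ}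
    (hα : α < d + 2) :
    ContinuousAt (Function.update (gammaPart d a) (d : ℝ) (gammaPartAtDim d a)) α := by
  by_cases h : α = d
  · subst h
    exact continuousAt_update_same.2 (tendsto_gammaPart_dim hd ha)
  · exact (continuousAt_update_of_ne h).2 (continuousAt_gammaPart ha hα h)

theorem continuous_besselLommelPart (d : ℕ) {a : ℝ} (ha : 0 < a) :
    Continuous (besselLommelPart d a) := by
  have hS (ν : ℝ) : Continuous fun w => lommelS w ν a :=
    continuous_iff_continuousAt.2 fun μ => continuousAt_lommelS ha μ ν
  have h1 : Continuous fun α : ℝ => a ^ (α + 1 - d) :=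
    (Real.continuous_const_rpow ha.ne').comp (by fun_prop)
  have h2 : Continuous fun α : ℝ => lommelS (((d : ℝ) - 2 - 2 * α) / 2) (((d : ℝ) - 4) / 2) a :=
    (hS _).comp (by fun_prop)
  have h3 : Continuous fun α : ℝ => lommelS (((d : ℝ) - 2 * α) / 2) (((d : ℝ) - 2) / 2) a :=
    (hS _).comp (by fun_prop)
  unfold besselLommelPart
  fun_prop

/-- The closed form of the spectral series, for every exponent `α < d + 2`. -/
theorem gammaPart_add_besselLommelPart {d : ℕ} (hd : 1 ≤ d) {a : ℝ} (ha : 0 < a) {α : ℝ}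
    (hα : α < d + 2) :
    Function.update (gammaPart d a) (d : ℝ) (gammaPartAtDim d a) α + besselLommelPart d a α =
      spectralSeries d a α := by
  have h1 := ((continuousAt_update_gammaPart hd ha hα).add
    (continuous_besselLommelPart d ha).continuousAt).tendsto.mono_left
    (nhdsWithin_le_nhds (s := {α}ᶜ))
  have h2 := (analyticAt_spectralSeries d a hα).continuousAt.tendsto.mono_left
    (nhdsWithin_le_nhds (s := {α}ᶜ))
  -- Exceptional exponents are isolated, so the generic identity holds on a punctured neighbourhood
  -- and both continuous sides agree at its centre.
  refine tendsto_nhds_unique h1 (h2.congr' ?_)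
  have hinj {f : ℝ → ℝ} (hf : Continuous f) (hf' : Function.Injective f) :
      Tendsto f (𝓝[≠] α) (𝓝[≠] (f α)) :=
    tendsto_nhdsWithin_of_tendsto_nhds_of_eventually_within _
      (hf.continuousAt.tendsto.mono_left nhdsWithin_le_nhds)
      (by filter_upwards [self_mem_nhdsWithin] with w hw using hf'.ne hw)
  have e1 := (hinj (f := fun α : ℝ => ((d : ℝ) - 2 * α) / 2) (by fun_prop)
    (fun x y h => by dsimp only at h; linarith)).eventually
    (eventually_lommelS_eq _ (((d : ℝ) - 2) / 2) a)
  have e2 := (hinj (f := fun α : ℝ => ((d : ℝ) - 2 * α) / 2 - 1) (by fun_prop)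
    (fun x y h => by dsimp only at h; linarith)).eventually
    (eventually_lommelS_eq _ (((d : ℝ) - 2) / 2 - 1) a)
  have e3 : ∀ᶠ w : ℝ in 𝓝[≠] α, w ≠ (d : ℝ) := by
    by_cases h : α = d
    · rw [h]; exact self_mem_nhdsWithin
    · exact (eventually_ne_nhds h).filter_mono nhdsWithin_le_nhds
  filter_upwards [e1, e2, e3] with w h1 h2 h3
  rw [← gammaPart_add_besselLommelPart_of_generic ha rfl rfl h1 h2, Pi.add_apply,
    Function.update_of_ne h3]

/-! ### Even moments of radial functions via Gaussians and polar coordinates. -/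

theorem Gamma_nat_add_half_eq (n : ℕ) :
    Real.Gamma (n + 1 / 2) = √Real.pi * ((2 * n).factorial : ℝ) / (4 ^ n * (n.factorial : ℝ)) := by
  induction n with
  | zero => simpa using Real.Gamma_one_half_eq
  | succ n ih =>
    have h : ((n + 1 : ℕ) : ℝ) + 1 / 2 = (n + 1 / 2) + 1 := by push_cast; ring
    rw [h, Real.Gamma_add_one (by positivity), ih, show 2 * (n + 1) = 2 * n + 1 + 1 by ring,
      Nat.factorial_succ, Nat.factorial_succ, Nat.factorial_succ n, pow_succ]
    push_cast
    field_simp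
    ring

theorem integral_even_pow_mul_exp_neg_sq (n : ℕ) :
    ∫ t : ℝ, t ^ (2 * n) * Real.exp (-t ^ 2) = Real.Gamma (n + 1 / 2) := by
  have h1 : ∫ t : ℝ, t ^ (2 * n) * Real.exp (-t ^ 2) =
      ∫ t : ℝ, (fun s : ℝ => s ^ (2 * n) * Real.exp (-s ^ 2)) |t| := by
    congr 1
    ext t
    simp [pow_mul]
  rw [h1, integral_comp_abs (f := fun s : ℝ => s ^ (2 * n) * Real.exp (-s ^ 2))]
  have h2 := integral_rpow_mul_exp_neg_rpow (p := 2) (q := (2 * n : ℕ)) two_pos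
    (by have : (0 : ℝ) ≤ (2 * n : ℕ) := Nat.cast_nonneg _
        linarith)
  simp only [Real.rpow_natCast, Real.rpow_ofNat] at h2
  rw [h2]
  push_cast
  rw [show (2 * (n : ℝ) + 1) / 2 = n + 1 / 2 by ring]
  ring

theorem integral_Ioi_pow_mul_exp_neg_sq (m : ℕ) :
    ∫ r in Ioi (0 : ℝ), r ^ m * Real.exp (-r ^ 2) = 1 / 2 * Real.Gamma ((m + 1) / 2) := by
  have h2 := integral_rpow_mul_exp_neg_rpow (p := 2) (q := (m : ℕ)) two_pos
    (by have : (0 : ℝ) ≤ (m : ℕ) := Nat.cast_nonneg _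
        linarith)
  simpa only [Real.rpow_natCast, Real.rpow_ofNat] using h2

/-- In an orthonormal basis containing $k/\|k\|$ the integrand is a product of one-variable
functions: one Gaussian moment and $d-1$ plain Gaussians. -/
theorem integral_exp_neg_norm_sq_mul_inner_pow {d : ℕ} (k : EuclideanSpace ℝ (Fin d)) (hk : k ≠ 0)
    (n : ℕ) :
    ∫ x : EuclideanSpace ℝ (Fin d), Real.exp (-‖x‖ ^ 2) * (inner ℝ k x : ℝ) ^ (2 * n) =
      ‖k‖ ^ (2 * n) * √Real.pi ^ (d - 1) * Real.Gamma (n + 1 / 2) := by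
  have hd : d ≠ 0 := by
    rintro rfl
    exact hk (Subsingleton.elim _ _)
  let i₀ : Fin d := ⟨0, Nat.pos_of_ne_zero hd⟩
  have hk' : ‖k‖ ≠ 0 := norm_ne_zero_iff.2 hk
  obtain ⟨b, hb⟩ := Orthonormal.exists_orthonormalBasis_extension_of_card_eq (𝕜 := ℝ)
    (E := EuclideanSpace ℝ (Fin d)) (ι := Fin d) (by simp)
    (v := fun _ => (‖k‖⁻¹ : ℝ) • k) (s := {i₀}) (by
      constructor
      · intro i
        simp [norm_smul, hk']
      · intro i j hij
        exact absurd (Subsingleton.elim i j) hij)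
  have hbk : k = ‖k‖ • b i₀ := by
    rw [hb i₀ rfl, smul_smul, mul_inv_cancel₀ hk', one_smul]
  have h1 : ∫ x : EuclideanSpace ℝ (Fin d), Real.exp (-‖x‖ ^ 2) * (inner ℝ k x : ℝ) ^ (2 * n) =
      ∫ y : EuclideanSpace ℝ (Fin d), Real.exp (-‖y‖ ^ 2) * (‖k‖ * y i₀) ^ (2 * n) := by
    rw [← b.measurePreserving_repr.integral_comp b.repr.toHomeomorph.measurableEmbedding
      (fun y : EuclideanSpace ℝ (Fin d) => Real.exp (-‖y‖ ^ 2) * (‖k‖ * y i₀) ^ (2 * n))]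
    congr 1
    ext x
    rw [b.repr.norm_map, b.repr_apply_apply]
    conv_lhs => rw [hbk]
    rw [real_inner_smul_left]
  rw [h1, ← (PiLp.volume_preserving_toLp (Fin d)).integral_comp
    (MeasurableEquiv.toLp 2 (Fin d → ℝ)).measurableEmbedding]
  let F (i : Fin d) (t : ℝ) : ℝ :=
    (if i = i₀ then ‖k‖ ^ (2 * n) * t ^ (2 * n) else 1) * Real.exp (-t ^ 2)
  have h2 (y : Fin d → ℝ) : Real.exp (-‖(WithLp.toLp 2 y : EuclideanSpace ℝ (Fin d))‖ ^ 2) *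
      (‖k‖ * (WithLp.toLp 2 y : EuclideanSpace ℝ (Fin d)) i₀) ^ (2 * n) =
      ∏ i, F i (y i) := by
    simp only [F]
    rw [EuclideanSpace.norm_sq_eq, ← Finset.sum_neg_distrib, Real.exp_sum, Finset.prod_mul_distrib,
      Finset.prod_ite_eq' Finset.univ i₀]
    simp [mul_pow, mul_comm]
  rw [integral_congr_ae (Eventually.of_forall h2), integral_fintype_prod_volume_eq_prod F,
    ← Finset.mul_prod_erase _ _ (Finset.mem_univ i₀),
    Finset.prod_congr rfl (g := fun _ => √Real.pi) (fun i hi => ?_)]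
  · simp only [F, if_true, Finset.prod_const, Finset.card_erase_of_mem (Finset.mem_univ i₀),
      Finset.card_univ, Fintype.card_fin, mul_assoc]
    rw [integral_const_mul, integral_even_pow_mul_exp_neg_sq]
    ring
  · simp only [F, if_neg (Finset.ne_of_mem_erase hi), one_mul]
    simpa using integral_gaussian 1

theorem integral_norm_mul_inner_pow {E : Type*} [NormedAddCommGroup E] [InnerProductSpace ℝ E]
    [FiniteDimensional ℝ E] [Nontrivial E] [MeasurableSpace E] [BorelSpace E] (k : E) (m : ℕ)
    (f : ℝ → ℝ) :
    ∫ x : E, f ‖x‖ * (inner ℝ k x : ℝ) ^ m =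
      (∫ ω : Metric.sphere (0 : E) 1, (inner ℝ k (ω : E) : ℝ) ^ m
        ∂(volume : Measure E).toSphere) *
      ∫ r in Ioi (0 : ℝ), r ^ (Module.finrank ℝ E - 1) * (f r * r ^ m) := by
  calc
    _ = ∫ x : ({(0)}ᶜ : Set E), f ‖x.1‖ * (inner ℝ k x.1 : ℝ) ^ m
        ∂((volume : Measure E).comap (↑)) := by
      rw [integral_subtype_comap (measurableSet_singleton _).compl
        fun x : E => f ‖x‖ * (inner ℝ k x : ℝ) ^ m, restrict_compl_singleton]
    _ = ∫ x, (inner ℝ k (x.1 : E) : ℝ) ^ m * (f x.2 * (x.2 : ℝ) ^ m)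
        ∂((volume : Measure E).toSphere.prod (.volumeIoiPow (Module.finrank ℝ E - 1))) := by
      rw [← (volume : Measure E).measurePreserving_homeomorphUnitSphereProd.integral_comp
        (Homeomorph.measurableEmbedding _)]
      congr 1
      ext x
      have hx : ‖x.1‖ ≠ 0 := norm_ne_zero_iff.2 x.2
      simp only [homeomorphUnitSphereProd_apply_snd_coe, homeomorphUnitSphereProd_apply_fst_coe,
        real_inner_smul_right, mul_pow, inv_pow]
      field_simp
    _ = (∫ ω : Metric.sphere (0 : E) 1, (inner ℝ k (ω : E) : ℝ) ^ m
          ∂(volume : Measure E).toSphere) *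
        ∫ r : Ioi (0 : ℝ), f r * (r : ℝ) ^ m ∂.volumeIoiPow (Module.finrank ℝ E - 1) :=
      integral_prod_mul (fun ω : Metric.sphere (0 : E) 1 => (inner ℝ k (ω : E) : ℝ) ^ m)
        (fun r : Ioi (0 : ℝ) => f r * (r : ℝ) ^ m)
    _ = _ := by
      congr 1
      simp only [Measure.volumeIoiPow, ENNReal.ofReal]
      rw [integral_withDensity_eq_integral_smul,
        integral_subtype_comap measurableSet_Ioi
          fun a : ℝ => Real.toNNReal (a ^ (Module.finrank ℝ E - 1)) • (f a * a ^ m),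
        setIntegral_congr_fun measurableSet_Ioi fun x hx => ?_]
      · simp only [NNReal.smul_def, Real.coe_toNNReal _ (pow_nonneg (le_of_lt hx) _), smul_eq_mul]
      · exact (measurable_subtype_coe.pow_const _).real_toNNReal

/-- Even moments of a radial function. -/
theorem integral_norm_mul_inner_even_pow {d : ℕ} (hd : 1 ≤ d) (k : EuclideanSpace ℝ (Fin d))
    (hk : k ≠ 0) (n : ℕ) (f : ℝ → ℝ) :
    ∫ x : EuclideanSpace ℝ (Fin d), f ‖x‖ * (inner ℝ k x : ℝ) ^ (2 * n) =
      2 * ‖k‖ ^ (2 * n) * √Real.pi ^ d * ((2 * n).factorial : ℝ) /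
        (4 ^ n * (n.factorial : ℝ) * Real.Gamma ((d : ℝ) / 2 + n)) *
      ∫ r in Ioi (0 : ℝ), r ^ (d - 1) * (f r * r ^ (2 * n)) := by
  have : Nonempty (Fin d) := ⟨⟨0, hd⟩⟩
  rw [integral_norm_mul_inner_pow, finrank_euclideanSpace_fin]
  congr 1
  -- The spherical factor does not depend on $f$, so the Gaussian, for which both other integrals
  -- are known, determines it.
  have h1 := integral_norm_mul_inner_pow k (2 * n) (fun r => Real.exp (-r ^ 2))
  rw [integral_exp_neg_norm_sq_mul_inner_pow k hk, finrank_euclideanSpace_fin] at h1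
  have h2 : ∫ r in Ioi (0 : ℝ), r ^ (d - 1) * (Real.exp (-r ^ 2) * r ^ (2 * n)) =
      1 / 2 * Real.Gamma ((d : ℝ) / 2 + n) := by
    have h3 := integral_Ioi_pow_mul_exp_neg_sq (d - 1 + 2 * n)
    have h4 : (((d - 1 + 2 * n : ℕ) : ℝ) + 1) / 2 = (d : ℝ) / 2 + n := by
      push_cast [Nat.cast_sub hd]; ring
    rw [h4] at h3
    rw [← h3]
    congr 1
    ext r
    rw [pow_add]; ring
  rw [h2, Gamma_nat_add_half_eq] at h1
  have hd0 : (0 : ℝ) < d := by exact_mod_cast hd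
  have hG : Real.Gamma ((d : ℝ) / 2 + n) ≠ 0 := (Real.Gamma_pos_of_pos (by positivity)).ne'
  have hs : √Real.pi ^ d = √Real.pi ^ (d - 1) * √Real.pi := by
    rw [← pow_succ, Nat.sub_add_cancel hd]
  rw [hs]
  field_simp at h1 ⊢
  linear_combination -h1

/-! ### Moments of the kernel and termwise integration of the cosine series. -/

theorem algebraicKernel_nonneg {d : ℕ} {α δ r : ℝ} (hδ : 0 < δ) (hα : α < d + 2) (hr : 0 ≤ r) :
    0 ≤ algebraicKernel d α δ r := by
  have : 0 < (d : ℝ) + 2 - α := by linarith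
  have hG : 0 < Real.Gamma ((d : ℝ) / 2 + 1) := Real.Gamma_pos_of_pos (by positivity)
  have : 0 ≤ r ^ α := Real.rpow_nonneg hr α
  rw [algebraicKernel]
  refine indicator_apply_nonneg fun _ => ?_
  positivity

theorem measurable_algebraicKernel (d : ℕ) (α δ : ℝ) : Measurable (algebraicKernel d α δ) := by
  refine Measurable.indicator ?_ measurableSet_Icc
  fun_prop

/-- The radial moments of the kernel. -/
theorem algebraicKernel_moment {d : ℕ} (hd : 1 ≤ d) {α δ : ℝ} (hδ : 0 < δ) {m : ℕ}
    (hm : α < d + m) :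
    IntegrableOn (fun r => r ^ (d - 1) * (algebraicKernel d α δ r * r ^ m)) (Ioi 0) ∧
    ∫ r in Ioi (0 : ℝ), r ^ (d - 1) * (algebraicKernel d α δ r * r ^ m) =
      2 * Real.Gamma ((d : ℝ) / 2 + 1) * ((d : ℝ) + 2 - α) /
        (Real.pi ^ ((d : ℝ) / 2) * δ ^ ((d : ℝ) + 2 - α)) * (δ ^ (d + m - α) / (d + m - α)) := by
  set C := 2 * Real.Gamma ((d : ℝ) / 2 + 1) * ((d : ℝ) + 2 - α) /
        (Real.pi ^ ((d : ℝ) / 2) * δ ^ ((d : ℝ) + 2 - α)) with hC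
  have e : EqOn (fun r => r ^ (d - 1) * (algebraicKernel d α δ r * r ^ m))
      ((Ioc 0 δ).indicator fun r => C * r ^ ((d : ℝ) + m - α - 1)) (Ioi 0) := by
    intro r hr
    have hr' : 0 < r := hr
    by_cases h : r ≤ δ
    · have hp : r ^ ((d : ℝ) + m - α - 1) = r ^ (d - 1) * r ^ m / r ^ α := by
        rw [show (d : ℝ) + m - α - 1 = ((d - 1 + m : ℕ) : ℝ) - α by
          push_cast [Nat.cast_sub hd]; ring, Real.rpow_sub hr', Real.rpow_natCast, pow_add]
      simp only [algebraicKernel]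
      rw [indicator_of_mem (show r ∈ Icc 0 δ from ⟨hr'.le, h⟩),
        indicator_of_mem (show r ∈ Ioc 0 δ from ⟨hr', h⟩), hp, hC]
      simp only [div_eq_mul_inv, mul_inv]
      ring
    · simp only [algebraicKernel]
      rw [indicator_of_notMem (fun h' => h h'.2), indicator_of_notMem (fun h' => h h'.2)]
      simp
  have hexp : -1 < (d : ℝ) + m - α - 1 := by linarith
  have hint : IntegrableOn (fun r => C * r ^ ((d : ℝ) + m - α - 1)) (Ioc 0 δ) :=
    ((intervalIntegral.intervalIntegrable_rpow' (a := 0) (b := δ) hexp).1).const_mul C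
  constructor
  · rw [integrableOn_congr_fun e measurableSet_Ioi]
    exact (((integrable_indicator_iff measurableSet_Ioc).2 hint)).integrableOn
  · rw [setIntegral_congr_fun measurableSet_Ioi e, setIntegral_indicator measurableSet_Ioc,
      inter_eq_self_of_subset_right (fun x hx => hx.1), ← intervalIntegral.integral_of_le hδ.le,
      intervalIntegral.integral_const_mul, integral_rpow (Or.inl hexp), sub_add_cancel,
      Real.zero_rpow (by linarith), sub_zero]

theorem integrable_algebraicKernel_mul_norm_pow {d : ℕ} (hd : 1 ≤ d) {α δ : ℝ} (hδ : 0 < δ)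
    {m : ℕ} (hm : α < d + m) :
    Integrable fun x : EuclideanSpace ℝ (Fin d) => algebraicKernel d α δ ‖x‖ * ‖x‖ ^ m := by
  have : Nonempty (Fin d) := ⟨⟨0, hd⟩⟩
  rw [integrable_fun_norm_addHaar volume (f := fun r => algebraicKernel d α δ r * r ^ m),
    finrank_euclideanSpace_fin]
  exact (algebraicKernel_moment hd hδ hm).1

theorem integrable_algebraicKernel_mul {d : ℕ} (hd : 1 ≤ d) {α δ : ℝ} (hδ : 0 < δ)
    (hα : α < d + 2) {m : ℕ} (hm : α < d + m) {F : Type*} [NormedAddCommGroup F]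
    [NormedSpace ℝ F] {g : EuclideanSpace ℝ (Fin d) → F} (hg : Continuous g) {B : ℝ}
    (hB : ∀ x, ‖g x‖ ≤ B * ‖x‖ ^ m) :
    Integrable fun x => algebraicKernel d α δ ‖x‖ • g x := by
  refine ((integrable_algebraicKernel_mul_norm_pow hd hδ hm).const_mul B).mono'
    ((((measurable_algebraicKernel d α δ).comp measurable_norm).aestronglyMeasurable).smul
      hg.aestronglyMeasurable) (Eventually.of_forall fun x => ?_)
  have h0 := algebraicKernel_nonneg hδ hα (norm_nonneg x)
  rw [norm_smul, Real.norm_of_nonneg h0]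
  calc _ ≤ algebraicKernel d α δ ‖x‖ * (B * ‖x‖ ^ m) := by gcongr; exact hB x
    _ = _ := by ring

/-- The term of order `2n` in the expansion of `ρ_δ(|x|) cos(k·x)`. -/
noncomputable def kernelTerm (d : ℕ) (α δ : ℝ) (k : EuclideanSpace ℝ (Fin d)) (n : ℕ)
    (x : EuclideanSpace ℝ (Fin d)) : ℝ :=
  algebraicKernel d α δ ‖x‖ * ((-1) ^ n * (inner ℝ k x : ℝ) ^ (2 * n) / ((2 * n).factorial : ℝ))

theorem integrable_kernelTerm {d : ℕ} (hd : 1 ≤ d) {α δ : ℝ} (hδ : 0 < δ) (hα : α < d + 2)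
    (k : EuclideanSpace ℝ (Fin d)) (n : ℕ) : Integrable (kernelTerm d α δ k (n + 1)) := by
  refine integrable_algebraicKernel_mul hd hδ hα (m := 2 * (n + 1)) ?_
    (g := fun x => (-1) ^ (n + 1) * (inner ℝ k x : ℝ) ^ (2 * (n + 1)) /
      ((2 * (n + 1)).factorial : ℝ)) (by fun_prop)
    (B := ‖k‖ ^ (2 * (n + 1)) / ((2 * (n + 1)).factorial : ℝ)) ?_
  · have : (0 : ℝ) ≤ n := n.cast_nonneg
    push_cast
    linarith
  · intro x
    rw [norm_div, norm_mul, norm_pow, norm_neg, norm_one, one_pow, one_mul, norm_pow,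
      RCLike.norm_natCast, div_mul_eq_mul_div, ← mul_pow]
    gcongr
    exact norm_inner_le_norm k x

/-- Each term has constant sign, so summability of the $L^1$ norms, needed for termwise integration,
reduces to absolute convergence of the spectral series. -/
theorem integral_norm_kernelTerm {d : ℕ} {α δ : ℝ} (hδ : 0 < δ) (hα : α < d + 2)
    (k : EuclideanSpace ℝ (Fin d)) (n : ℕ) :
    (-1) ^ (n + 1) * ∫ x, ‖kernelTerm d α δ k (n + 1) x‖ =
    ∫ x, kernelTerm d α δ k (n + 1) x := by
  rw [← integral_const_mul]
  congr 1
  ext x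
  have h0 := algebraicKernel_nonneg hδ hα (norm_nonneg x)
  have h1 : (0 : ℝ) ≤ (inner ℝ k x : ℝ) ^ (2 * (n + 1)) := by rw [pow_mul]; positivity
  rw [kernelTerm, norm_mul, Real.norm_of_nonneg h0, norm_div, norm_mul, norm_pow, norm_neg,
    norm_one, one_pow, one_mul, Real.norm_of_nonneg h1, RCLike.norm_natCast]
  ring

theorem integral_kernelTerm {d : ℕ} (hd : 1 ≤ d) {α δ : ℝ} (hδ : 0 < δ) (hα : α < d + 2)
    (k : EuclideanSpace ℝ (Fin d)) (hk : k ≠ 0) (n : ℕ) :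
    ∫ x, kernelTerm d α δ k (n + 1) x =
      2 * Real.Gamma ((d : ℝ) / 2 + 1) * ((d : ℝ) + 2 - α) / δ ^ 2 *
      ((-(‖k‖ * δ / 2) ^ 2) ^ (n + 1) / (((n + 1).factorial : ℝ) *
        Real.Gamma ((d : ℝ) / 2 + (n + 1 : ℕ)) * (((d : ℝ) - α) / 2 + (n + 1 : ℕ)))) := by
  have h1 := integral_norm_mul_inner_even_pow hd k hk (n + 1) (algebraicKernel d α δ)
  have hn : (0 : ℝ) ≤ n := n.cast_nonneg
  have hm : α < d + ((2 * (n + 1) : ℕ) : ℝ) := by push_cast; linarith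
  rw [(algebraicKernel_moment hd hδ hm).2] at h1
  have h2 : ∫ x, kernelTerm d α δ k (n + 1) x = (-1) ^ (n + 1) / ((2 * (n + 1)).factorial : ℝ) *
      ∫ x : EuclideanSpace ℝ (Fin d),
        algebraicKernel d α δ ‖x‖ * (inner ℝ k x : ℝ) ^ (2 * (n + 1)) := by
    rw [← integral_const_mul]
    congr 1
    ext x
    rw [kernelTerm]
    ring
  rw [h2, h1]
  have hpi : Real.pi ^ ((d : ℝ) / 2) = √Real.pi ^ d := by
    rw [Real.sqrt_eq_rpow, ← Real.rpow_natCast, ← Real.rpow_mul Real.pi_pos.le]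
    congr 1; ring
  have hpow : δ ^ ((d : ℝ) + ((2 * (n + 1) : ℕ) : ℝ) - α) =
      δ ^ ((d : ℝ) + 2 - α) * δ ^ (2 * (n + 1)) / δ ^ 2 := by
    rw [show (d : ℝ) + ((2 * (n + 1) : ℕ) : ℝ) - α = ((d : ℝ) + 2 - α) + ((2 * (n + 1) : ℕ) : ℝ) -
      (2 : ℕ) by push_cast; ring, Real.rpow_sub hδ, Real.rpow_add hδ, Real.rpow_natCast,
      Real.rpow_natCast]
  have hd1 : (d : ℝ) + ((2 * (n + 1) : ℕ) : ℝ) - α ≠ 0 := by linarith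
  have hd2 : ((d : ℝ) - α) / 2 + (n + 1 : ℕ) =
      ((d : ℝ) + ((2 * (n + 1) : ℕ) : ℝ) - α) / 2 := by push_cast; ring
  have hd0 : (0 : ℝ) < d := by exact_mod_cast hd
  have hG : Real.Gamma ((d : ℝ) / 2 + (n + 1 : ℕ)) ≠ 0 :=
    (Real.Gamma_pos_of_pos (by positivity)).ne'
  have hx : (-(‖k‖ * δ / 2) ^ 2) ^ (n + 1) =
      (-1) ^ (n + 1) * ‖k‖ ^ (2 * (n + 1)) * δ ^ (2 * (n + 1)) / 4 ^ (n + 1) := by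
    rw [← neg_one_mul, mul_pow, div_pow, mul_pow, div_pow, mul_pow, ← pow_mul, ← pow_mul]
    norm_num
    ring
  rw [hpi, hpow, hd2, hx]
  have hp : 0 < δ ^ ((d : ℝ) + 2 - α) := Real.rpow_pos_of_pos hδ _
  generalize δ ^ ((d : ℝ) + 2 - α) = P at *
  generalize (d : ℝ) + ((2 * (n + 1) : ℕ) : ℝ) - α = Q at *
  generalize Real.Gamma ((d : ℝ) / 2 + (n + 1 : ℕ)) = G at *
  generalize Real.Gamma ((d : ℝ) / 2 + 1) = G' at *
  have : √Real.pi ≠ 0 := by positivity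
  field_simp

theorem integral_algebraicKernel_mul_cos_sub_one {d : ℕ} (hd : 1 ≤ d) {α δ : ℝ} (hδ : 0 < δ)
    (hα : α < d + 2) (k : EuclideanSpace ℝ (Fin d)) (hk : k ≠ 0) :
    ∫ x : EuclideanSpace ℝ (Fin d), algebraicKernel d α δ ‖x‖ * (Real.cos (inner ℝ k x) - 1) =
      2 * Real.Gamma ((d : ℝ) / 2 + 1) * ((d : ℝ) + 2 - α) / δ ^ 2 *
        spectralSeries d (‖k‖ * δ) α := by
  have hs : Summable fun n => ∫ x, ‖kernelTerm d α δ k (n + 1) x‖ := by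
    have h := (((summable_spectralTerm d (‖k‖ * δ) (((d : ℝ) - α) / 2 : ℝ)).comp_injective
      (add_left_injective 1)).norm).mul_left
        ‖2 * Real.Gamma ((d : ℝ) / 2 + 1) * ((d : ℝ) + 2 - α) / δ ^ 2‖
    refine h.congr fun n => ?_
    have h1 := congrArg norm (integral_norm_kernelTerm hδ hα k n)
    rw [norm_mul, norm_pow, norm_neg, norm_one, one_pow, one_mul, Real.norm_of_nonneg
      (integral_nonneg fun _ => norm_nonneg _), integral_kernelTerm hd hδ hα k hk, norm_mul] at h1
    rw [h1, Function.comp_apply, spectralTerm_ofReal, Complex.norm_real]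
  have h := hasSum_integral_of_summable_integral_norm
    (integrable_kernelTerm hd hδ hα k) hs
  have hcos (x : EuclideanSpace ℝ (Fin d)) :
      ∑' n, kernelTerm d α δ k (n + 1) x =
        algebraicKernel d α δ ‖x‖ * (Real.cos (inner ℝ k x) - 1) := by
    have h1 := (hasSum_nat_add_iff' 1).2 (Real.hasSum_cos (inner ℝ k x))
    simp only [Finset.range_one, Finset.sum_singleton, pow_zero, mul_zero, Nat.factorial_zero,
      Nat.cast_one, div_one, mul_one] at h1
    exact (h1.mul_left (algebraicKernel d α δ ‖x‖)).tsum_eq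
  simp only [hcos, integral_kernelTerm hd hδ hα k hk] at h
  rw [← h.tsum_eq, tsum_mul_left, spectralSeries]

/-! ### The principal value and the eigenvalue. -/

/-- Dominated convergence. The origin lies in no annulus with $\varepsilon>0$ and may be an atom of
$\mu$, whence the condition $g(0)=0$. -/
theorem tendsto_setIntegral_annulus {E F : Type*} [NormedAddCommGroup E] [MeasurableSpace E]
    [BorelSpace E] [NormedAddCommGroup F] [NormedSpace ℝ F] {μ : Measure E} {g : E → F} {δ : ℝ}
    (hg : IntegrableOn g (Metric.closedBall 0 δ) μ) (hg0 : g 0 = 0) :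
    Tendsto (fun ε : ℝ => ∫ x in Metric.closedBall 0 δ \ Metric.ball 0 ε, g x ∂μ) (𝓝[>] 0)
      (𝓝 (∫ x in Metric.closedBall 0 δ, g x ∂μ)) := by
  have h (ε : ℝ) : ∫ x in Metric.closedBall 0 δ \ Metric.ball 0 ε, g x ∂μ =
      ∫ x in Metric.closedBall 0 δ, (Metric.ball (0 : E) ε)ᶜ.indicator g x ∂μ := by
    rw [setIntegral_indicator measurableSet_ball.compl, sdiff_eq]
  simp only [h]
  refine tendsto_integral_filter_of_dominated_convergence (fun x => ‖g x‖)
    (Eventually.of_forall fun ε => hg.aestronglyMeasurable.indicator measurableSet_ball.compl)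
    (Eventually.of_forall fun ε => Eventually.of_forall fun x => norm_indicator_le_norm_self _ _)
    hg.norm (Eventually.of_forall fun x => ?_)
  by_cases hx : x = 0
  · subst hx
    refine tendsto_const_nhds.congr fun ε => ?_
    by_cases h0 : (0 : E) ∈ (Metric.ball (0 : E) ε)ᶜ
    · rw [indicator_of_mem h0]
    · rw [indicator_of_notMem h0, hg0]
  · refine tendsto_const_nhds.congr' ?_
    filter_upwards [Ioo_mem_nhdsGT (norm_pos_iff.2 hx)] with ε hε
    rw [indicator_of_mem]
    simpa using hε.2.le

theorem eigenvalueIntegrand_eq_smul (d : ℕ) (α δ : ℝ) (k x : EuclideanSpace ℝ (Fin d)) :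
    eigenvalueIntegrand d α δ k x = algebraicKernel d α δ ‖x‖ •
      (Complex.exp (Complex.I * ((inner ℝ k x : ℝ) : ℂ)) - 1) := by
  rw [eigenvalueIntegrand, Complex.real_smul]

theorem eigenvalueIntegrand_zero (d : ℕ) (α δ : ℝ) (k : EuclideanSpace ℝ (Fin d)) :
    eigenvalueIntegrand d α δ k 0 = 0 := by
  simp [eigenvalueIntegrand]

theorem norm_exp_inner_sub_one_le {d : ℕ} (k x : EuclideanSpace ℝ (Fin d)) :
    ‖Complex.exp (Complex.I * ((inner ℝ k x : ℝ) : ℂ)) - 1‖ ≤ ‖k‖ * ‖x‖ :=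
  (Real.norm_exp_I_mul_ofReal_sub_one_le).trans (norm_inner_le_norm k x)

theorem re_eigenvalueIntegrand (d : ℕ) (α δ : ℝ) (k x : EuclideanSpace ℝ (Fin d)) :
    (eigenvalueIntegrand d α δ k x).re =
      algebraicKernel d α δ ‖x‖ * (Real.cos (inner ℝ k x) - 1) := by
  rw [eigenvalueIntegrand, Complex.re_ofReal_mul, mul_comm Complex.I, Complex.sub_re,
    Complex.exp_ofReal_mul_I_re, Complex.one_re]

theorem integrable_algebraicKernel_mul_cos_sub_one {d : ℕ} (hd : 1 ≤ d) {α δ : ℝ} (hδ : 0 < δ)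
    (hα : α < d + 2) (k : EuclideanSpace ℝ (Fin d)) :
    Integrable fun x : EuclideanSpace ℝ (Fin d) =>
      algebraicKernel d α δ ‖x‖ * (Real.cos (inner ℝ k x) - 1) := by
  refine integrable_algebraicKernel_mul hd hδ hα (m := 2) (by exact_mod_cast hα)
    (g := fun x => Real.cos (inner ℝ k x) - 1) (by fun_prop) (B := ‖k‖ ^ 2 / 2) fun x => ?_
  have h1 := Real.one_sub_sq_div_two_le_cos (x := inner ℝ k x)
  have h2 : (inner ℝ k x : ℝ) ^ 2 ≤ ‖k‖ ^ 2 * ‖x‖ ^ 2 := by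
    rw [← mul_pow, ← sq_abs]
    gcongr
    exact abs_real_inner_le_norm k x
  rw [Real.norm_eq_abs, abs_le]
  constructor
  · linarith
  · have := Real.cos_le_one (inner ℝ k x)
    have : 0 ≤ ‖k‖ ^ 2 / 2 * ‖x‖ ^ 2 := by positivity
    linarith

theorem integrable_eigenvalueIntegrand {d : ℕ} (hd : 1 ≤ d) {α δ : ℝ} (hδ : 0 < δ)
    (hα : α < d + 1) (k : EuclideanSpace ℝ (Fin d)) : Integrable (eigenvalueIntegrand d α δ k) := by
  have h := integrable_algebraicKernel_mul hd hδ (by linarith) (m := 1) (by exact_mod_cast hα)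
    (g := fun x => Complex.exp (Complex.I * ((inner ℝ k x : ℝ) : ℂ)) - 1) (by fun_prop) (B := ‖k‖)
    (fun x => by rw [pow_one]; exact norm_exp_inner_sub_one_le k x)
  exact h.congr (Eventually.of_forall fun x => (eigenvalueIntegrand_eq_smul d α δ k x).symm)

/-- Away from the origin $\|x\|\le\|x\|^2/\varepsilon$, so the second moment of the kernel, finite
for $\alpha<d+2$, dominates the integrand. -/
theorem integrableOn_eigenvalueIntegrand_annulus {d : ℕ} (hd : 1 ≤ d) {α δ : ℝ} (hδ : 0 < δ)
    (hα : α < d + 2) (k : EuclideanSpace ℝ (Fin d)) {ε : ℝ} (hε : 0 < ε) :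
    IntegrableOn (eigenvalueIntegrand d α δ k) (Metric.closedBall 0 δ \ Metric.ball 0 ε) := by
  have h := ((integrable_algebraicKernel_mul_norm_pow hd hδ (m := 2)
    (by exact_mod_cast hα)).const_mul (‖k‖ / ε)).integrableOn
      (s := Metric.closedBall (0 : EuclideanSpace ℝ (Fin d)) δ \ Metric.ball 0 ε)
  refine Integrable.mono' h ?_ ?_
  · have h1 : Measurable fun x : EuclideanSpace ℝ (Fin d) => algebraicKernel d α δ ‖x‖ :=
      (measurable_algebraicKernel d α δ).comp measurable_norm
    have h2 : Continuous fun x : EuclideanSpace ℝ (Fin d) =>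
        Complex.exp (Complex.I * ((inner ℝ k x : ℝ) : ℂ)) - 1 := by fun_prop
    exact ((Complex.measurable_ofReal.comp h1).mul h2.measurable).aestronglyMeasurable
  · filter_upwards [ae_restrict_mem (measurableSet_closedBall.diff measurableSet_ball)] with x hx
    have hx' : ε ≤ ‖x‖ := by simpa using hx.2
    have h0 := algebraicKernel_nonneg hδ hα (norm_nonneg x)
    rw [eigenvalueIntegrand_eq_smul, norm_smul, Real.norm_of_nonneg h0]
    calc _ ≤ algebraicKernel d α δ ‖x‖ * (‖k‖ * ‖x‖) := by
          gcongr; exact norm_exp_inner_sub_one_le k x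
      _ ≤ algebraicKernel d α δ ‖x‖ * (‖k‖ * ‖x‖ * (‖x‖ / ε)) := by
          refine mul_le_mul_of_nonneg_left ?_ h0
          exact le_mul_of_one_le_right (by positivity) ((one_le_div hε).2 hx')
      _ = _ := by ring

theorem eigenvalueIntegrand_neg (d : ℕ) (α δ : ℝ) (k x : EuclideanSpace ℝ (Fin d)) :
    eigenvalueIntegrand d α δ k (-x) = (starRingEnd ℂ) (eigenvalueIntegrand d α δ k x) := by
  simp only [eigenvalueIntegrand, norm_neg, inner_neg_right, map_mul, Complex.conj_ofReal, map_sub,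
    map_one, ← Complex.exp_conj, Complex.conj_I]
  push_cast
  ring_nf

/-- The annulus is invariant under $x\mapsto-x$, which conjugates the integrand. This cancellation
is why the principal value exists beyond $\alpha=d+1$. -/
theorem im_truncatedEigenvalue (d : ℕ) (α δ : ℝ) (k : EuclideanSpace ℝ (Fin d)) (ε : ℝ) :
    (truncatedEigenvalue d α δ k ε).im = 0 := by
  rw [← Complex.conj_eq_iff_im, truncatedEigenvalue, ← integral_conj]
  simp only [← eigenvalueIntegrand_neg]
  have hS : MeasurableSet (Metric.closedBall (0 : EuclideanSpace ℝ (Fin d)) δ \ Metric.ball 0 ε) :=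
    measurableSet_closedBall.diff measurableSet_ball
  rw [← integral_indicator hS, ← integral_indicator hS, ← integral_neg_eq_self]
  congr 1
  ext x
  by_cases hx : x ∈ Metric.closedBall (0 : EuclideanSpace ℝ (Fin d)) δ \ Metric.ball 0 ε
  · rw [indicator_of_mem hx, indicator_of_mem (by simpa using hx), neg_neg]
  · rw [indicator_of_notMem hx, indicator_of_notMem (by simpa using hx)]

theorem truncatedEigenvalue_eq {d : ℕ} (hd : 1 ≤ d) {α δ : ℝ} (hδ : 0 < δ)
    (hα : α < d + 2) (k : EuclideanSpace ℝ (Fin d)) {ε : ℝ} (hε : 0 < ε) :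
    truncatedEigenvalue d α δ k ε =
      ((∫ x in Metric.closedBall 0 δ \ Metric.ball 0 ε,
        algebraicKernel d α δ ‖x‖ * (Real.cos (inner ℝ k x) - 1) : ℝ) : ℂ) := by
  apply Complex.ext
  · rw [Complex.ofReal_re, truncatedEigenvalue]
    have h := integral_re (𝕜 := ℂ) (integrableOn_eigenvalueIntegrand_annulus hd hδ hα k hε)
    simp only [RCLike.re_to_complex, re_eigenvalueIntegrand] at h
    exact h.symm
  · rw [im_truncatedEigenvalue, Complex.ofReal_im]

theorem tendsto_truncatedEigenvalue_cos {d : ℕ} (hd : 1 ≤ d) {α δ : ℝ} (hδ : 0 < δ)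
    (hα : α < d + 2) (k : EuclideanSpace ℝ (Fin d)) :
    Tendsto (truncatedEigenvalue d α δ k) (𝓝[>] 0)
      (𝓝 ((∫ x : EuclideanSpace ℝ (Fin d),
        algebraicKernel d α δ ‖x‖ * (Real.cos (inner ℝ k x) - 1) : ℝ) : ℂ)) := by
  have h := tendsto_setIntegral_annulus (δ := δ)
    (integrable_algebraicKernel_mul_cos_sub_one hd hδ hα k).integrableOn (by simp)
  rw [setIntegral_eq_integral_of_forall_compl_eq_zero] at h
  · refine ((Complex.continuous_ofReal.tendsto _).comp h).congr' ?_
    filter_upwards [self_mem_nhdsWithin] with ε hε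
    exact (truncatedEigenvalue_eq hd hδ hα k hε).symm
  · intro x hx
    rw [algebraicKernel, indicator_of_notMem, zero_mul]
    intro h
    exact hx (by simpa using h.2)

theorem eigenvalue_eq {d : ℕ} (hd : 1 ≤ d) {α δ : ℝ} (hδ : 0 < δ)
    (hα : α < d + 2) (k : EuclideanSpace ℝ (Fin d)) :
    eigenvalue d α δ k = ((∫ x : EuclideanSpace ℝ (Fin d),
        algebraicKernel d α δ ‖x‖ * (Real.cos (inner ℝ k x) - 1) : ℝ) : ℂ) :=
  (tendsto_truncatedEigenvalue_cos hd hδ hα k).limUnder_eq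

theorem tendsto_truncatedEigenvalue {d : ℕ} (hd : 1 ≤ d) {α δ : ℝ} (hδ : 0 < δ)
    (hα : α < d + 2) (k : EuclideanSpace ℝ (Fin d)) :
    Tendsto (truncatedEigenvalue d α δ k) (𝓝[>] 0) (𝓝 (eigenvalue d α δ k)) := by
  rw [eigenvalue_eq hd hδ hα]
  exact tendsto_truncatedEigenvalue_cos hd hδ hα k

theorem scaledEigenvalue_eq {d : ℕ} (hd : 1 ≤ d) {α δ : ℝ} (hδ : 0 < δ)
    (hα : α < d + 2) (k : EuclideanSpace ℝ (Fin d)) (hk : k ≠ 0) :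
    scaledEigenvalue d α δ k = (spectralSeries d (‖k‖ * δ) α : ℂ) := by
  have hd0 : (d : ℝ) + 2 - α ≠ 0 := by linarith
  have hG : Real.Gamma ((d : ℝ) / 2 + 1) ≠ 0 := (Real.Gamma_pos_of_pos (by positivity)).ne'
  rw [scaledEigenvalue, eigenvalue_eq hd hδ hα,
    integral_algebraicKernel_mul_cos_sub_one hd hδ hα k hk, ← Complex.ofReal_pow,
    ← Complex.ofReal_mul, ← Complex.ofReal_div]
  congr 1
  field_simp

end NonlocalSpectra

theorem mainTheorem3 (d : ℕ) (hd : 1 ≤ d) (δ : ℝ) (hδ : 0 < δ)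
    (k : EuclideanSpace ℝ (Fin d)) (hk : k ≠ 0) :
    -- the eigenvalue exists as a principal value, and is an absolutely convergent integral
    -- for `α < d + 1`
    (∀ α ∈ Set.Ico (0 : ℝ) (d + 2),
      Filter.Tendsto (NonlocalSpectra.truncatedEigenvalue d α δ k) (nhdsWithin 0 (Set.Ioi 0))
        (nhds (NonlocalSpectra.eigenvalue d α δ k))) ∧
    (∀ α ∈ Set.Ico (0 : ℝ) (d + 1),
      MeasureTheory.IntegrableOn (NonlocalSpectra.eigenvalueIntegrand d α δ k)
        (Metric.closedBall 0 δ) ∧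
      NonlocalSpectra.eigenvalue d α δ k =
        ∫ r in Metric.closedBall 0 δ, NonlocalSpectra.eigenvalueIntegrand d α δ k r) ∧
    -- the closed form for `α ≠ d`
    (∀ α ∈ Set.Ico (0 : ℝ) (d + 2), α ≠ d →
      NonlocalSpectra.scaledEigenvalue d α δ k =
        ((NonlocalSpectra.gammaPart d (‖k‖ * δ) α +
          NonlocalSpectra.besselLommelPart d (‖k‖ * δ) α : ℝ) : ℂ)) ∧
    -- the singularity at `α = d` is removable, with an explicit limit
    Filter.Tendsto (NonlocalSpectra.gammaPart d (‖k‖ * δ)) (nhdsWithin (d : ℝ) {(d : ℝ)}ᶜ)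
      (nhds (NonlocalSpectra.gammaPartAtDim d (‖k‖ * δ))) ∧
    -- the closed form for `α = d`
    NonlocalSpectra.scaledEigenvalue d d δ k =
      ((NonlocalSpectra.gammaPartAtDim d (‖k‖ * δ) +
        NonlocalSpectra.besselLommelPart d (‖k‖ * δ) d : ℝ) : ℂ) ∧
    -- both sides are analytic functions of `α` on `[0, d + 2)`
    AnalyticOn ℝ (fun α : ℝ => NonlocalSpectra.scaledEigenvalue d α δ k)
      (Set.Ico (0 : ℝ) (d + 2)) ∧
    AnalyticOn ℝ
      (fun α : ℝ =>
        Function.update (NonlocalSpectra.gammaPart d (‖k‖ * δ)) (d : ℝ)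
            (NonlocalSpectra.gammaPartAtDim d (‖k‖ * δ)) α +
          NonlocalSpectra.besselLommelPart d (‖k‖ * δ) α)
      (Set.Ico (0 : ℝ) (d + 2)) := by
  have ha : 0 < ‖k‖ * δ := mul_pos (norm_pos_iff.2 hk) hδ
  have hd2 : (d : ℝ) < d + 2 := by linarith
  have hclosed {α : ℝ} (hα : α < d + 2) := NonlocalSpectra.gammaPart_add_besselLommelPart hd ha hα
  have heq {α : ℝ} (hα : α < d + 2) := NonlocalSpectra.scaledEigenvalue_eq hd hδ hα k hk
  refine ⟨fun α hα => NonlocalSpectra.tendsto_truncatedEigenvalue hd hδ hα.2 k,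
    fun α hα => ?_, fun α hα hαd => ?_, NonlocalSpectra.tendsto_gammaPart_dim hd ha, ?_, ?_, ?_⟩
  · have hint := (NonlocalSpectra.integrable_eigenvalueIntegrand hd hδ hα.2 k).integrableOn
      (s := Metric.closedBall 0 δ)
    exact ⟨hint, tendsto_nhds_unique
      (NonlocalSpectra.tendsto_truncatedEigenvalue hd hδ (by linarith [hα.2]) k)
      (NonlocalSpectra.tendsto_setIntegral_annulus hint
        (NonlocalSpectra.eigenvalueIntegrand_zero d α δ k))⟩
  · rw [heq hα.2, ← hclosed hα.2, Function.update_of_ne hαd]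
  · rw [heq hd2, ← hclosed hd2, Function.update_self]
  -- Both functions coincide on $[0,d+2)$ with the spectral series, from which they inherit
  -- analyticity.
  · intro α hα
    have h := (NonlocalSpectra.analyticAt_spectralSeries d (‖k‖ * δ) hα.2)
    have h' := AnalyticAt.fun_comp (Complex.ofRealCLM.analyticAt _) h
    exact h'.analyticWithinAt.congr (fun w hw => heq hw.2) (heq hα.2)
  · intro α hα
    exact (NonlocalSpectra.analyticAt_spectralSeries d (‖k‖ * δ) hα.2).analyticWithinAt.congr
      (fun w hw => hclosed hw.2) (hclosed hα.2)
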